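/- **Theorem (existence of finite-summable spectral triples).** Let $a>0$ be a real number with $a\neq 1$. Let $B_a=\{\sum_i m_i a^{n_i} : m_i,n_i\in\mathbb Z,\ \text{finite sums}\}\subset\mathbb R$ (as a discrete group), let $G_a=B_a\rtimes\mathbb Z$ with $(b,n)(b',n')=(b+a^nb',\,n+n')$, put $u=(0,1)$ and $v=(1,0)$, and let $\mathcal U_a=C^*(G_a)$ be the full group $C^*$-algebra, with dense $*$-subalgebra $\mathbb C[G_a]$. A *spectral triple* here consists of a faithful $*$-representation $\pi$ of $\mathcal U_a$ on a Hilbert space $\mathcal H$ and an unbounded self-adjoint operator $D$ on $\mathcal H$ such that $[D,\pi(x)]$ is bounded for every $x\in\mathbb C[G_a]$ (i.e. $\pi(x)$ preserves $\mathrm{dom}\,D$ and $D\pi(x)-\pi(x)D$ extends to a bounded operator, denoted $[D,\pi(x)]$) and $(1+D^2)^{-1}$ is compact. For real $p\ge 1$ it is *$p$-summable* if $\mathrm{Tr}\big((1+D^2)^{-p/2}\big)<\infty$; it has *summability exactly $p$* if it is $p$-summable and is not $r$-summable for any $1\le r<p$. For a character $\chi:B_a\to\mathbb T$ let $\hat\alpha(\chi)(b)=\chi(ab)$.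 If $\chi$ is a periodic point of $\hat\alpha$ with exact period $q\ge1$, and $x\in\mathbb T$, let $\pi_{x,\chi}$ be the representation of $\mathcal U_a$ on $\mathbb C^q$ with orthonormal basis $e_0,\dots,e_{q-1}$ given by $\pi_{x,\chi}(b,0)e_s=\chi(a^sb)e_s$ for $b \in B_a$, $\pi_{x,\chi}(u)e_s=e_{s-1}$ for $1\le s<q$, and $\pi_{x,\chi}(u)e_0=x\,e_{q-1}$. Call a representation *of periodic-point type* if it is a Hilbert space direct sum of representations $\pi_{x,\chi}$, over some family of pairs $(x,\chi)$ as above. Then: (i) There is a spectral triple, with $\pi$ of periodic-point type, such that $[D,\pi(x)]$ is compact for all $x\in\mathbb C[G_a]$. (ii) For every real $p\ge1$ there is a spectral triple, with $\pi$ of periodic-point type, such that $[D,\pi(x)]=0$ for all $x\in\mathcal U_a$ and with summability exactly $p$. (iii) If $a$ is algebraic, then for every real $p\ge2$ there is a spectral triple, with $\pi$ of periodic-point type, such that $[D,\pi(v)]=0$ and $[D,\pi(u)]\neq0$ and with summability exactly $p$. -/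

import Mathlib

open scoped ENNReal InnerProductSpace

noncomputable section

/-! ### The full C*-algebra of a discrete group -/

/-- A unitary representation of the discrete group `G` on a nonzero complex Hilbert space. -/
structure UnitaryRep (G : Type) [Group G] where
  /-- the Hilbert space -/
  H : Type
  [normed : NormedAddCommGroup H]
  [inner : InnerProductSpace ℂ H]
  [complete : CompleteSpace H]
  [nontriv : Nontrivial H]
  /-- the representation by unitary operators -/
  ρ : G →* unitary (H →L[ℂ] H)

attribute [instance] UnitaryRep.normed UnitaryRep.inner UnitaryRep.complete UnitaryRep.nontriv

section GroupCStar

variable (G : Type) [Group G]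

/-- The bounded families `(T_r)`, with `T_r` a bounded operator on the space of the unitary
representation `r`, under the supremum norm. -/
abbrev RepFamilies : Type 1 := lp (fun r : UnitaryRep G => r.H →L[ℂ] r.H) ∞

instance : CStarAlgebra (RepFamilies G) where

variable {G}

/-- The image of a group element in all unitary representations at once. -/
def univRep (g : G) : RepFamilies G :=
  ⟨fun r => (r.ρ g : r.H →L[ℂ] r.H), memℓp_infty ⟨1, by
    rintro _ ⟨r, rfl⟩
    exact (CStarRing.norm_of_mem_unitary (r.ρ g).2).le⟩⟩

variable (G)

/-- The full group C*-algebra `C*(G)`: the closure of the group algebra in the norm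
`‖x‖ = sup ‖ρ(x)‖` over all unitary representations `ρ` of `G`, that is, the C*-algebra
generated by `G` in the product of all its unitary representations. (Representations of
the discrete group `G : Type` on Hilbert spaces in `Type` suffice for that supremum,
because every representation is a direct sum of cyclic ones.) -/
abbrev GroupCStar : Type 1 :=
  (StarAlgebra.adjoin ℂ (Set.range (univRep (G := G)))).topologicalClosure

instance : IsClosed
    ((StarAlgebra.adjoin ℂ (Set.range (univRep (G := G)))).topologicalClosure :
      Set (RepFamilies G)) :=
  StarSubalgebra.isClosed_topologicalClosure _

variable {G}

/-- The canonical image in `C*(G)` of a group element. -/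
def GroupCStar.of (g : G) : GroupCStar G :=
  ⟨univRep g, StarSubalgebra.le_topologicalClosure _
    (StarAlgebra.subset_adjoin ℂ _ (Set.mem_range_self g))⟩

variable (G)

/-- The group algebra `ℂ[G]` inside `C*(G)`: the star-subalgebra generated by `G`, which consists
of the finite linear combinations of group elements. -/
def groupAlg : StarSubalgebra ℂ (GroupCStar G) :=
  StarAlgebra.adjoin ℂ (Set.range (GroupCStar.of (G := G)))

end GroupCStar

/-! ### Spectral triples -/

section Operators

variable {H : Type} [NormedAddCommGroup H] [InnerProductSpace ℂ H] [CompleteSpace H]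

/-- `C` is the commutator `[D, b]` of the unbounded operator `D` with the bounded operator `b`:
`b` preserves the domain of `D`, and on it `D b - b D` agrees with the bounded operator `C`. -/
def IsCommutator (D : H →ₗ.[ℂ] H) (b C : H →L[ℂ] H) : Prop :=
  ∀ ξ : D.domain, ∃ h : b ξ ∈ D.domain, D ⟨b ξ, h⟩ - b (D ξ) = C ξ

/-- `R` is the inverse `(1 + D²)⁻¹`, where `D²` has the domain
`{ξ ∈ dom D | D ξ ∈ dom D}`. -/
def IsInvOneAddSq (D : H →ₗ.[ℂ] H) (R : H →L[ℂ] H) : Prop :=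
  (∀ η : H, ∃ (h : R η ∈ D.domain) (h' : D ⟨R η, h⟩ ∈ D.domain),
      R η + D ⟨D ⟨R η, h⟩, h'⟩ = η) ∧
  ∀ (ξ : D.domain) (h : D ξ ∈ D.domain), R (ξ + D ⟨D ξ, h⟩) = ξ

/-- The positive bounded operator `T` has finite trace: `∑ ⟪eᵢ, T eᵢ⟫ < ∞` for an orthonormal
basis `e` of `H` (for positive `T` the sum does not depend on the basis). -/
def HasFiniteTrace (T : H →L[ℂ] H) : Prop :=
  ∃ (ι : Type) (e : HilbertBasis ι ℂ H), Summable fun i => (⟪e i, T (e i)⟫_ℂ).re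

end Operators

/-- A spectral triple `(π(𝒜), H, D)` over the unital C*-algebra `A`, where `𝒜` is a norm dense
star-subalgebra of `A`: a faithful representation `π` of `A` on the Hilbert space `H` and an
unbounded self-adjoint operator `D` on `H` such that `[D, π(x)]` is bounded for all `x ∈ 𝒜` and
`(1 + D²)⁻¹` is compact. -/
structure SpectralTriple (A : Type 1) [CStarAlgebra A] (𝒜 : StarSubalgebra ℂ A) where
  /-- the Hilbert space -/
  H : Type
  [normed : NormedAddCommGroup H]
  [inner : InnerProductSpace ℂ H]
  [complete : CompleteSpace H]
  /-- the representation -/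
  π : A →⋆ₐ[ℂ] (H →L[ℂ] H)
  /-- the Dirac operator -/
  D : H →ₗ.[ℂ] H
  dense_alg : Dense (𝒜 : Set A)
  faithful : Function.Injective π
  dense_domain : Dense (D.domain : Set H)
  selfAdjoint : IsSelfAdjoint D
  bounded_commutator : ∀ x ∈ 𝒜, ∃ C : H →L[ℂ] H, IsCommutator D (π x) C
  compact_resolvent : ∃ R : H →L[ℂ] H, IsInvOneAddSq D R ∧ IsCompactOperator R

attribute [instance] SpectralTriple.normed SpectralTriple.inner SpectralTriple.complete

namespace SpectralTriple

variable {A : Type 1} [CStarAlgebra A] {𝒜 : StarSubalgebra ℂ A}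

/-- The triple is compact: `[D, π(x)]` is a compact operator for all `x ∈ 𝒜`. -/
def IsCompactTriple (T : SpectralTriple A 𝒜) : Prop :=
  ∀ x ∈ 𝒜, ∃ C : T.H →L[ℂ] T.H, IsCommutator T.D (T.π x) C ∧ IsCompactOperator C

/-- `[D, π(x)] = 0`. -/
def CommutatorEqZero (T : SpectralTriple A 𝒜) (x : A) : Prop :=
  IsCommutator T.D (T.π x) 0

/-- `[D, π(x)]` is a nonzero bounded operator. -/
def CommutatorNeZero (T : SpectralTriple A 𝒜) (x : A) : Prop :=
  ∃ C : T.H →L[ℂ] T.H, IsCommutator T.D (T.π x) C ∧ C ≠ 0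

/-- `p`-summability: `Tr ((1 + D²)^(-p/2)) < ∞`. -/
def IsSummable (T : SpectralTriple A 𝒜) (p : ℝ) : Prop :=
  ∃ R : T.H →L[ℂ] T.H, IsInvOneAddSq T.D R ∧ HasFiniteTrace (R ^ (p / 2))

/-- The summability of the triple is exactly `p`: it is `p`-summable, and it is not `r`-summable
for any `r` with `1 ≤ r < p`. -/
def HasSummability (T : SpectralTriple A 𝒜) (p : ℝ) : Prop :=
  T.IsSummable p ∧ ∀ r : ℝ, 1 ≤ r → r < p → ¬ T.IsSummable r

end SpectralTriple

/-! ### The group `G_a = B_a ⋊ ℤ` and the algebra `U_a = C*(G_a)` -/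

/-- `B_a`: the finite sums `∑ mᵢ a ^ nᵢ` with `mᵢ, nᵢ ∈ ℤ`. -/
def Bgrp (a : ℝ) : AddSubgroup ℝ := AddSubgroup.closure (Set.range fun n : ℤ => a ^ n)

theorem zpow_mem_Bgrp (a : ℝ) (n : ℤ) : a ^ n ∈ Bgrp a :=
  AddSubgroup.subset_closure ⟨n, rfl⟩

theorem zpow_mul_mem_Bgrp {a : ℝ} (ha : 0 < a) (n : ℤ) {b : ℝ} (hb : b ∈ Bgrp a) :
    a ^ n * b ∈ Bgrp a := by
  induction hb using AddSubgroup.closure_induction with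
  | mem x hx =>
    obtain ⟨k, rfl⟩ := hx
    simpa [zpow_add₀ ha.ne'] using zpow_mem_Bgrp a (n + k)
  | zero => simp
  | add x y _ _ hx hy => rw [mul_add]; exact add_mem hx hy
  | neg x _ hx => rw [mul_neg]; exact neg_mem hx

section Group

variable {a : ℝ} (ha : 0 < a)

/-- Multiplication by `a ^ n` as an automorphism of `B_a`. -/
def scale (n : ℤ) : Bgrp a ≃+ Bgrp a where
  toFun b := ⟨a ^ n * b, zpow_mul_mem_Bgrp ha n b.2⟩
  invFun b := ⟨a ^ (-n) * b, zpow_mul_mem_Bgrp ha (-n) b.2⟩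
  left_inv b := by
    ext; simp [(zpow_pos ha n).ne']
  right_inv b := by
    ext; simp [(zpow_pos ha n).ne']
  map_add' b c := by ext; simp [mul_add]

/-- The action `n ↦ (b ↦ a ^ n * b)` of `ℤ` on `B_a`, both groups written multiplicatively. -/
def scaleAction : Multiplicative ℤ →* MulAut (Multiplicative (Bgrp a)) where
  toFun n := AddEquiv.toMultiplicative (scale ha n.toAdd)
  map_one' := by
    refine MulEquiv.ext fun b => Multiplicative.toAdd.injective (Subtype.ext ?_)
    simp [scale]
  map_mul' m n := by
    refine MulEquiv.ext fun b => Multiplicative.toAdd.injective (Subtype.ext ?_)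
    simp [scale, zpow_add₀ ha.ne', mul_assoc]

/-- `G_a = B_a ⋊ ℤ`, with `(b, n) (b', n') = (b + a ^ n * b', n + n')`. -/
abbrev Ggrp : Type := Multiplicative (Bgrp a) ⋊[scaleAction ha] Multiplicative ℤ

/-- The element `(b, 0)` of `G_a`. -/
def Ggrp.ofB (b : Bgrp a) : Ggrp ha := SemidirectProduct.inl (Multiplicative.ofAdd b)

/-- The generator `u = (0, 1)`. -/
def Ggrp.u : Ggrp ha := SemidirectProduct.inr (Multiplicative.ofAdd 1)

/-- The generator `v = (1, 0)`. -/
def Ggrp.v : Ggrp ha := Ggrp.ofB ha ⟨1, by simpa using zpow_mem_Bgrp a 0⟩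

/-- The C*-algebra `U_a = C*(G_a)`. -/
abbrev Ualg : Type 1 := GroupCStar (Ggrp ha)

/-- The dense subalgebra `ℂ[G_a]` of `U_a`. -/
abbrev Galg : StarSubalgebra ℂ (Ualg ha) := groupAlg (Ggrp ha)

/-! ### Periodic points and the residually finite representations they define -/

/-- The automorphism `χ ↦ χ ∘ (b ↦ a b)` of the Pontryagin dual of the discrete group `B_a`. -/
def dualMap (χ : AddChar (Bgrp a) Circle) : AddChar (Bgrp a) Circle :=
  χ.compAddMonoidHom (scale ha 1).toAddMonoidHom

/-- `χ` is a periodic point with exact period `q ≥ 1`. -/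
def IsPeriodicPoint (q : ℕ) (χ : AddChar (Bgrp a) Circle) : Prop :=
  0 < q ∧ Function.minimalPeriod (dualMap ha) χ = q

/-- The representation `π` is a Hilbert space direct sum of finite dimensional representations
`π_{x,χ}` given by periodic points `χ` of the dual of `B_a` and numbers `x` on the unit circle.
For `χ` of period `q`, the representation `π_{x,χ}` on `ℂ^q` with basis `e_0, …, e_{q-1}` is
`π(b) e_s = χ(a ^ s b) e_s` for `b ∈ B_a`, `π(u) e_s = e_{s-1}` for `1 ≤ s < q`, and
`π(u) e_0 = x e_{q-1}`. -/
def IsPeriodicPointRep {H : Type} [NormedAddCommGroup H] [InnerProductSpace ℂ H]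
    [CompleteSpace H] (π : Ualg ha →⋆ₐ[ℂ] (H →L[ℂ] H)) : Prop :=
  ∃ (ι : Type) (q : ι → ℕ) (χ : ι → AddChar (Bgrp a) Circle) (x : ι → Circle)
    (e : HilbertBasis (Σ i, Fin (q i)) ℂ H),
    (∀ i, IsPeriodicPoint ha (q i) (χ i)) ∧
    (∀ (i : ι) (s : Fin (q i)) (b : Bgrp a),
      π (GroupCStar.of (Ggrp.ofB ha b)) (e ⟨i, s⟩) =
        (((dualMap ha)^[(s : ℕ)] (χ i) b : Circle) : ℂ) • e ⟨i, s⟩) ∧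
    (∀ (i : ι) (s t : Fin (q i)), (t : ℕ) + 1 = s →
      π (GroupCStar.of (Ggrp.u ha)) (e ⟨i, s⟩) = e ⟨i, t⟩) ∧
    (∀ (i : ι) (s t : Fin (q i)), (s : ℕ) = 0 → (t : ℕ) + 1 = q i →
      π (GroupCStar.of (Ggrp.u ha)) (e ⟨i, s⟩) = (x i : ℂ) • e ⟨i, t⟩)

end Group

end

/-! Take `π` to be the direct sum of `π_{x,χ}` over enough pairs `(x, χ)` to be faithful, with `D`
diagonal in the resulting basis. Elements of `B_a` then commute with `D`, and `u` only shifts within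
finite blocks. If `D` is a scalar on each block, everything commutes with `D`. If it is a scalar
plus `1` on the first vector of each block, `[D, π(u)]` is bounded, and it is nonzero as soon as
some block has dimension above one.

Faithfulness rests on two facts. First, `G_a` is amenable (`Ggrp.folnerCondition`), so a
representation whose vector functionals reproduce the canonical trace on finite sets dominates every
other one in norm (`UnitaryRep.norm_alg_le`, `UnitaryRep.toCStar_injective`). Second, periodic
characters are plentiful. The ring `ℤ[a, a⁻¹]` is a Noetherian domain, finitely generated over `ℤ`,
so for a maximal ideal `m` the quotients by `m ^ n` are finite and the powers intersect in zero
(`exists_ideal_finite_quotient_pow`). Characters of these quotients are periodic, and averaging over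
them and over roots of unity `x` gives the canonical trace (`hasRegularCoefficients_orbitRep`).

The summability is set by the eigenvalues alone. A block of dimension `q` and weight `w` receives
eigenvalues near `(q w) ^ (1/p)`, so it contributes about `1 / w` to the `p`-trace, and at least a
constant times `w ^ (-r/p)` to the `r`-trace when `r < p`. The weights are chosen so that the first
sum is finite and the second infinite. `exists_spectralTriple` assembles this with a parameter `t`
for the perturbation. -/

noncomputable section

/-! ### Operators diagonal in a Hilbert basis: compactness, functional calculus, trace. -/

section DiagonalOperators

variable {X H : Type} [NormedAddCommGroup H] [InnerProductSpace ℂ H]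

/-- Bounded operators that agree on a Hilbert basis are equal. -/
theorem HilbertBasis.clm_ext (e : HilbertBasis X ℂ H) {A B : H →L[ℂ] H}
    (h : ∀ p, A (e p) = B (e p)) : A = B := by
  refine ContinuousLinearMap.ext_on (s := Set.range e) ?_ ?_
  · exact Submodule.dense_iff_topologicalClosure_eq_top.2 e.dense_span
  · rintro _ ⟨p, rfl⟩; exact h p

theorem HilbertBasis.inner_eq_ite (e : HilbertBasis X ℂ H) [DecidableEq X] (p q : X) :
    ⟪e p, e q⟫_ℂ = if p = q then 1 else 0 :=
  orthonormal_iff_ite.1 e.orthonormal p q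

theorem HilbertBasis.apply_ne_zero (e : HilbertBasis X ℂ H) (p : X) : e p ≠ 0 :=
  e.orthonormal.ne_zero p

theorem exists_lp_mul (c : X → ℂ) (C : ℝ) (hC : 0 ≤ C) (hc : ∀ p, ‖c p‖ ≤ C) :
    ∃ T : lp (fun _ : X => ℂ) 2 →L[ℂ] lp (fun _ : X => ℂ) 2,
      (∀ f p, T f p = c p * f p) ∧ ‖T‖ ≤ C := by
  have two : (0 : ℝ) < (2 : ℝ≥0∞).toReal := by norm_num
  have key : ∀ (f : lp (fun _ : X => ℂ) 2) (p : X),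
      ‖c p * f p‖ ^ (2 : ℝ≥0∞).toReal ≤ C ^ (2 : ℝ≥0∞).toReal * ‖f p‖ ^ (2 : ℝ≥0∞).toReal := by
    intro f p
    rw [← Real.mul_rpow hC (norm_nonneg _), norm_mul]
    exact Real.rpow_le_rpow (by positivity)
      (mul_le_mul_of_nonneg_right (hc p) (norm_nonneg _)) two.le
  have hs : ∀ f : lp (fun _ : X => ℂ) 2, Summable fun p => ‖c p * f p‖ ^ (2 : ℝ≥0∞).toReal :=
    fun f => Summable.of_nonneg_of_le (fun p => by positivity) (key f)
      (((lp.memℓp f).summable two).mul_left _)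
  let L : lp (fun _ : X => ℂ) 2 →ₗ[ℂ] lp (fun _ : X => ℂ) 2 :=
    { toFun := fun f => ⟨fun p => c p * f p, memℓp_gen (hs f)⟩
      map_add' := fun f g => by ext p; exact mul_add _ _ _
      map_smul' := fun r f => by ext p; simp [mul_left_comm] }
  refine ⟨L.mkContinuous C fun f => ?_, fun f p => rfl, L.mkContinuous_norm_le hC _⟩
  refine lp.norm_le_of_tsum_le two (by positivity) ?_
  rw [Real.mul_rpow hC (norm_nonneg _), lp.norm_rpow_eq_tsum two, ← tsum_mul_left]
  exact (hs f).tsum_le_tsum (key f) (((lp.memℓp f).summable two).mul_left _)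

/-- A bounded family of numbers is the diagonal of a bounded operator. -/
theorem HilbertBasis.exists_diag (e : HilbertBasis X ℂ H) (c : X → ℂ) (C : ℝ) (hC : 0 ≤ C)
    (hc : ∀ p, ‖c p‖ ≤ C) :
    ∃ T : H →L[ℂ] H, (∀ p, T (e p) = c p • e p) ∧ ‖T‖ ≤ C := by
  classical
  obtain ⟨T, hT, hTn⟩ := exists_lp_mul c C hC hc
  refine ⟨(e.repr.symm.toContinuousLinearEquiv : _ →L[ℂ] H) ∘L T ∘L
    (e.repr.toContinuousLinearEquiv : H →L[ℂ] _), fun p => ?_, ?_⟩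
  · change e.repr.symm (T (e.repr (e p))) = _
    rw [LinearIsometryEquiv.symm_apply_eq, map_smul, e.repr_self]
    ext q
    rw [hT]
    by_cases h : q = p
    · subst h; simp
    · simp [h]
  · refine ContinuousLinearMap.opNorm_le_bound _ hC fun x => ?_
    change ‖e.repr.symm (T (e.repr x))‖ ≤ _
    rw [LinearIsometryEquiv.norm_map]
    refine (T.le_opNorm _).trans ?_
    rw [LinearIsometryEquiv.norm_map]
    gcongr

/-- A diagonal operator whose entries tend to zero is compact. -/
theorem HilbertBasis.isCompactOperator_of_tendsto [CompleteSpace H] (e : HilbertBasis X ℂ H)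
    {c : X → ℂ} (hc : Filter.Tendsto c Filter.cofinite (nhds 0)) {T : H →L[ℂ] H}
    (hT : ∀ p, T (e p) = c p • e p) : IsCompactOperator T := by
  classical
  let F : Finset X → H →L[ℂ] H := fun s =>
    ∑ p ∈ s, c p • (innerSL ℂ (e p)).smulRight (e p)
  have hF : ∀ s q, F s (e q) = (if q ∈ s then c q else 0) • e q := by
    intro s q
    simp [F, e.inner_eq_ite]
  refine _root_.isCompactOperator_of_tendsto (l := Filter.atTop) (F := F) ?_
    (Filter.Eventually.of_forall fun s => ?_)
  · rw [tendsto_iff_norm_sub_tendsto_zero]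
    rw [Metric.tendsto_atTop]
    intro ε hε
    have hfin := (Metric.tendsto_nhds.1 hc) (ε / 2) (by positivity)
    rw [Filter.eventually_cofinite] at hfin
    refine ⟨hfin.toFinset, fun s hs => ?_⟩
    obtain ⟨T', hT', hn⟩ := e.exists_diag (fun q => (if q ∈ s then c q else 0) - c q) (ε / 2)
      (by positivity) (fun q => by
        by_cases hq : q ∈ s
        · simp [hq]; positivity
        · have : q ∉ hfin.toFinset := fun h => hq (hs h)
          simp only [Set.Finite.mem_toFinset, Set.mem_ofPred_eq, not_not, dist_zero_right] at this
          simpa [hq] using this.le)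
    have : F s - T = T' := e.clm_ext fun q => by simp [hF, hT, hT', sub_smul]
    rw [this]
    simp only [dist_zero_right, norm_norm]
    linarith
  · have hmem : F s ∈ {T : H →L[ℂ] H | IsCompactOperator T} := by
      refine Submodule.sum_mem (compactOperator (RingHom.id ℂ) H H) fun p _ => ?_
      refine Submodule.smul_mem _ _ ?_
      have h1 : IsCompactOperator (innerSL ℂ (e p)) :=
        isCompactOperator_of_locallyCompactSpace_dom _
      exact h1.clm_comp ((ContinuousLinearMap.id ℂ ℂ).smulRight (e p))
    exact hmem

variable [CompleteSpace H]

theorem HilbertBasis.adjoint_diag (e : HilbertBasis X ℂ H) {c : X → ℂ} {T : H →L[ℂ] H}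
    (hT : ∀ p, T (e p) = c p • e p) (p : X) :
    star T (e p) = (starRingEnd ℂ) (c p) • e p := by
  classical
  refine e.repr.injective (Subtype.ext (funext fun q => ?_))
  rw [e.repr_apply_apply, e.repr_apply_apply, ContinuousLinearMap.star_eq_adjoint,
    ContinuousLinearMap.adjoint_inner_right, hT, inner_smul_left, inner_smul_right,
    e.inner_eq_ite]
  split_ifs with h
  · rw [h]
  · simp

theorem HilbertBasis.isSelfAdjoint_diag (e : HilbertBasis X ℂ H) {c : X → ℝ} {T : H →L[ℂ] H}
    (hT : ∀ p, T (e p) = (c p : ℂ) • e p) : IsSelfAdjoint T :=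
  e.clm_ext fun p => by rw [e.adjoint_diag hT, hT, Complex.conj_ofReal]

theorem HilbertBasis.repr_diag (e : HilbertBasis X ℂ H) {c : X → ℝ} {T : H →L[ℂ] H}
    (hT : ∀ p, T (e p) = (c p : ℂ) • e p) (x : H) (p : X) :
    ⟪e p, T x⟫_ℂ = c p * ⟪e p, x⟫_ℂ := by
  have := e.isSelfAdjoint_diag hT
  rw [← ContinuousLinearMap.adjoint_inner_left, ← ContinuousLinearMap.star_eq_adjoint,
    this.star_eq, hT, inner_smul_left, Complex.conj_ofReal]

theorem HilbertBasis.hasSum_inner_diag (e : HilbertBasis X ℂ H) {c : X → ℝ} {T : H →L[ℂ] H}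
    (hT : ∀ p, T (e p) = (c p : ℂ) • e p) (x : H) :
    HasSum (fun p => c p * ‖⟪e p, x⟫_ℂ‖ ^ 2) (⟪x, T x⟫_ℂ).re := by
  have := Complex.hasSum_re (e.hasSum_inner_mul_inner x (T x))
  convert this using 2 with p
  rw [e.repr_diag hT, ← inner_conj_symm x (e p), mul_left_comm, Complex.conj_mul']
  norm_cast

theorem HilbertBasis.hasSum_norm_sq (e : HilbertBasis X ℂ H) (x : H) :
    HasSum (fun p => ‖⟪e p, x⟫_ℂ‖ ^ 2) (‖x‖ ^ 2) := by
  have := e.hasSum_inner_diag (c := fun _ => 1) (T := ContinuousLinearMap.id ℂ H) (by simp) x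
  simp only [one_mul, ContinuousLinearMap.id_apply] at this
  rw [inner_self_eq_norm_sq_to_K] at this
  convert this using 1
  norm_cast

theorem HilbertBasis.nonneg_diag (e : HilbertBasis X ℂ H) {c : X → ℝ} (hc : ∀ p, 0 ≤ c p)
    {T : H →L[ℂ] H} (hT : ∀ p, T (e p) = (c p : ℂ) • e p) : 0 ≤ T := by
  rw [ContinuousLinearMap.nonneg_iff_isPositive, ContinuousLinearMap.isPositive_def']
  refine ⟨e.isSelfAdjoint_diag hT, fun x => ?_⟩
  rw [ContinuousLinearMap.reApplyInnerSelf_apply, inner_re_symm]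
  exact (e.hasSum_inner_diag hT x).nonneg fun p => mul_nonneg (hc p) (by positivity)

/-- The functional calculus of a diagonal operator is diagonal. -/
theorem cfc_apply_eigenvector {T : H →L[ℂ] H} (hT : IsSelfAdjoint T) {c : ℝ} {x : H} (hx : x ≠ 0)
    (hTx : T x = (c : ℂ) • x) {f : ℝ → ℝ} (hf : ContinuousOn f (spectrum ℝ T)) :
    cfc f T x = (f c : ℂ) • x := by
  have hc : c ∈ spectrum ℝ T := by
    rw [spectrum.mem_iff]
    intro hu
    obtain ⟨S, hS⟩ := hu.exists_left_inv
    apply hx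
    have : (S * (algebraMap ℝ (H →L[ℂ] H) c - T)) x = 0 := by
      rw [mul_apply_eq_comp]
      have : (algebraMap ℝ (H →L[ℂ] H) c - T) x = 0 := by
        rw [sub_apply, hTx, Algebra.algebraMap_eq_smul_one]
        simp
      rw [this, map_zero]
    rwa [hS] at this
  -- The functions `g` with this property form a closed subalgebra containing the identity function,
  -- so Stone–Weierstrass gives all of them.
  have key : ∀ g : C(spectrum ℝ T, ℝ), cfcHom hT g x = ((g ⟨c, hc⟩ : ℝ) : ℂ) • x := by
    intro g
    induction g using ContinuousMap.induction_on_of_compact with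
    | const r =>
      have : ContinuousMap.const (spectrum ℝ T) r = algebraMap ℝ _ r := rfl
      rw [this, AlgHomClass.commutes, Algebra.algebraMap_eq_smul_one]
      simp
    | id => rw [cfcHom_id hT, hTx]; rfl
    | star_id =>
      rw [map_star, cfcHom_id hT, hT.star_eq, hTx]; rfl
    | add f g hf hg => rw [map_add, add_apply, hf, hg]; simp [add_smul]
    | mul f g hf hg =>
      rw [map_mul, mul_apply_eq_comp, hg, map_smul, hf, smul_smul, ContinuousMap.mul_apply,
        Complex.ofReal_mul, mul_comm]
    | frequently f hf =>
      have hcl : IsClosed {g : C(spectrum ℝ T, ℝ) |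
          cfcHom hT g x = ((g ⟨c, hc⟩ : ℝ) : ℂ) • x} := by
        refine isClosed_eq ?_ ?_
        · exact (ContinuousLinearMap.apply ℂ H x).continuous.comp (cfcHom_continuous hT)
        · fun_prop
      exact hcl.closure_subset (mem_closure_iff_frequently.2 hf)
  rw [cfc_apply f T hT hf, key]
  rfl

/-- For `s ≥ 0` the power function is continuous at `0`, which may lie in the spectrum, so the
continuous functional calculus applies. -/
theorem HilbertBasis.rpow_diag (e : HilbertBasis X ℂ H) {c : X → ℝ} (hc : ∀ p, 0 ≤ c p)
    {T : H →L[ℂ] H} (hT : ∀ p, T (e p) = (c p : ℂ) • e p) {s : ℝ} (hs : 0 ≤ s) (p : X) :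
    (T ^ s) (e p) = ((c p ^ s : ℝ) : ℂ) • e p := by
  rw [CFC.rpow_eq_cfc_real (e.nonneg_diag hc hT)]
  exact cfc_apply_eigenvector (e.isSelfAdjoint_diag hT) (e.apply_ne_zero p) (hT p)
    (f := fun x => x ^ s) (Real.continuous_rpow_const hs).continuousOn

/-- The trace of a positive diagonal operator is the sum of its entries. -/
theorem HilbertBasis.hasFiniteTrace_diag_iff (e : HilbertBasis X ℂ H) {c : X → ℝ}
    (hc : ∀ p, 0 ≤ c p) {T : H →L[ℂ] H} (hT : ∀ p, T (e p) = (c p : ℂ) • e p) :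
    HasFiniteTrace T ↔ Summable c := by
  constructor
  · rintro ⟨ι, f, hf⟩
    -- The basis `f` is arbitrary. Parseval in `f` writes each `c p` as a sum over `i` of `c p * ‖⟪e
    -- p, f i⟫‖ ^ 2`; for fixed `i`, the sum over `p ∈ s` is at most `⟪f i, T (f i)⟫`.
    refine summable_of_sum_le (c := ∑' i, (⟪f i, T (f i)⟫_ℂ).re) hc fun s => ?_
    have h1 : HasSum (fun i => ∑ p ∈ s, c p * ‖⟪e p, f i⟫_ℂ‖ ^ 2) (∑ p ∈ s, c p) := by
      refine hasSum_sum fun p _ => ?_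
      have := (f.hasSum_norm_sq (e p)).mul_left (c p)
      simp only [e.orthonormal.1 p, one_pow, mul_one] at this
      simpa only [norm_inner_symm] using this
    rw [← h1.tsum_eq]
    refine h1.summable.tsum_le_tsum (fun i => ?_) hf
    have h2 := e.hasSum_inner_diag hT (f i)
    rw [← h2.tsum_eq]
    exact h2.summable.sum_le_tsum s fun p _ => mul_nonneg (hc p) (by positivity)
  · intro h
    refine ⟨X, e, h.congr fun p => ?_⟩
    rw [hT, inner_smul_right, inner_self_eq_norm_sq_to_K, e.orthonormal.1 p]
    simp

end DiagonalOperators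

/-! ### Unbounded operators `D = K⁻¹` treated through identities in the bounded operator `K`. -/

section InverseOperator

variable {H : Type} [NormedAddCommGroup H] [InnerProductSpace ℂ H]

/-- The inverse of an injective bounded operator, as an unbounded operator. -/
def invPMap (K : H →L[ℂ] H) (hK : Function.Injective K) : H →ₗ.[ℂ] H where
  domain := LinearMap.range (K : H →ₗ[ℂ] H)
  toFun := (LinearEquiv.ofInjective (K : H →ₗ[ℂ] H) hK).symm.toLinearMap

variable {K : H →L[ℂ] H} {hK : Function.Injective K}

theorem invPMap_mem (η : H) : K η ∈ (invPMap K hK).domain := ⟨η, rfl⟩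

theorem mem_invPMap_domain {ξ : H} : ξ ∈ (invPMap K hK).domain ↔ ∃ η, K η = ξ := Iff.rfl

theorem invPMap_apply (η : H) (h : K η ∈ (invPMap K hK).domain) : invPMap K hK ⟨K η, h⟩ = η :=
  (LinearEquiv.symm_apply_eq (LinearEquiv.ofInjective (K : H →ₗ[ℂ] H) hK)).2 (Subtype.ext rfl)

theorem invPMap_apply_of_eq {ξ η : H} (e : ξ = K η) (h : ξ ∈ (invPMap K hK).domain) :
    invPMap K hK ⟨ξ, h⟩ = η := by
  subst e; exact invPMap_apply η h

/-- Sandwiching `D b - b D = C` between two copies of `K = D⁻¹` removes every unbounded term. -/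
theorem isCommutator_invPMap [CompleteSpace H] {b C : H →L[ℂ] H}
    (h : b * K - K * b = K * C * K) : IsCommutator (invPMap K hK) b C := by
  rintro ⟨ξ, hξ⟩
  obtain ⟨η, rfl⟩ := mem_invPMap_domain.1 hξ
  have e : b (K η) = K (b η + C (K η)) := by
    have := congrArg (fun T : H →L[ℂ] H => T η) h
    simp only [sub_apply, mul_apply_eq_comp] at this
    rw [map_add, ← this]; abel
  refine ⟨mem_invPMap_domain.2 ⟨_, e.symm⟩, ?_⟩
  change invPMap K hK ⟨b (K η), _⟩ - b (invPMap K hK ⟨K η, hξ⟩) = C (K η)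
  rw [invPMap_apply_of_eq e, invPMap_apply]
  abel

/-- The hypotheses are `(1 + D²) R = 1` multiplied on the left by `K²`, and `R (1 + D²) = 1`
multiplied on the right by `K²`, whose range is the domain of `D²`. -/
theorem isInvOneAddSq_invPMap {R : H →L[ℂ] H} (h1 : R + K * K * R = K * K)
    (h2 : R + R * K * K = K * K) : IsInvOneAddSq (invPMap K hK) R := by
  have h1' : ∀ η, R η + K (K (R η)) = K (K η) := fun η =>
    congrArg (fun T : H →L[ℂ] H => T η) h1
  have h2' : ∀ η, R η + R (K (K η)) = K (K η) := fun η =>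
    congrArg (fun T : H →L[ℂ] H => T η) h2
  refine ⟨fun η => ?_, ?_⟩
  · have e : R η = K (K (η - R η)) := by
      rw [map_sub, map_sub, ← h1' η]; abel
    refine ⟨mem_invPMap_domain.2 ⟨_, e.symm⟩, mem_invPMap_domain.2 ⟨η - R η, ?_⟩, ?_⟩
    · exact (invPMap_apply_of_eq e _).symm
    · rw [invPMap_apply_of_eq (η := η - R η) (invPMap_apply_of_eq e _)]
      abel
  · rintro ⟨ξ, hξ⟩ h
    obtain ⟨η, rfl⟩ := mem_invPMap_domain.1 hξ
    have hη : invPMap K hK ⟨K η, hξ⟩ = η := invPMap_apply η _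
    obtain ⟨ζ, hζ⟩ := mem_invPMap_domain.1 h
    obtain rfl : K ζ = η := hζ.trans hη
    change R (K (K ζ) + invPMap K hK ⟨invPMap K hK ⟨K (K ζ), hξ⟩, h⟩) = K (K ζ)
    rw [invPMap_apply_of_eq (η := ζ) hη, map_add, add_comm, h2']

variable [CompleteSpace H]

/-- Symmetry is immediate. For `y` in the domain of the adjoint, pairing with `K η` gives `⟪K (D*
y), η⟫ = ⟪y, η⟫` for all `η`, so `y` lies in the range of `K`. -/
theorem isSelfAdjoint_invPMap (hs : IsSelfAdjoint K)
    (hd : Dense ((invPMap K hK).domain : Set H)) : IsSelfAdjoint (invPMap K hK) := by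
  have hsym : ∀ x y : H, ⟪K x, y⟫_ℂ = ⟪x, K y⟫_ℂ :=
    fun x y => (ContinuousLinearMap.isSelfAdjoint_iff_isSymmetric.1 hs) x y
  have hle : invPMap K hK ≤ (invPMap K hK).adjoint := by
    refine LinearPMap.IsFormalAdjoint.le_adjoint hd ?_
    rintro ⟨ξ, hξ⟩ ⟨ζ, hζ⟩
    obtain ⟨x, rfl⟩ := mem_invPMap_domain.1 hξ
    obtain ⟨y, rfl⟩ := mem_invPMap_domain.1 hζ
    change ⟪invPMap K hK ⟨K x, hξ⟩, K y⟫_ℂ = ⟪K x, invPMap K hK ⟨K y, hζ⟩⟫_ℂ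
    rw [invPMap_apply, invPMap_apply, hsym]
  refine (LinearPMap.eq_of_le_of_domain_eq hle (le_antisymm hle.1 fun y hy => ?_)).symm
  refine ⟨(invPMap K hK).adjoint ⟨y, hy⟩, ext_inner_right ℂ fun η => ?_⟩
  have := LinearPMap.adjoint_isFormalAdjoint hd ⟨y, hy⟩ ⟨K η, invPMap_mem η⟩
  rw [invPMap_apply] at this
  exact (hsym _ _).trans this

end InverseOperator

/-! ### The diagonal Dirac operator and its summability. -/

section DiagonalDirac

variable {X H : Type} [NormedAddCommGroup H] [InnerProductSpace ℂ H] [CompleteSpace H]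

/-- Operators with bounded commutator with `K⁻¹` form a star-subalgebra. -/
def boundedCommutatorSubalgebra (K : H →L[ℂ] H) (hK : IsSelfAdjoint K) :
    StarSubalgebra ℂ (H →L[ℂ] H) where
  carrier := {b | ∃ C : H →L[ℂ] H, b * K - K * b = K * C * K}
  mul_mem' := by
    rintro b c ⟨C, hC⟩ ⟨C', hC'⟩
    -- The Leibniz rule for `[D, b c]`.
    refine ⟨b * C' + C * c, ?_⟩
    have h1 : b * K = K * b + K * C * K := by rw [← hC]; abel
    have h2 : K * c = c * K - K * C' * K := by rw [← hC']; abel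
    calc b * c * K - K * (b * c) = b * (c * K - K * c) + (b * K - K * b) * c := by noncomm_ring
      _ = (b * K) * C' * K + K * C * (K * c) := by rw [hC, hC']; noncomm_ring
      _ = _ := by rw [h1, h2]; noncomm_ring
  add_mem' := by
    rintro b c ⟨C, hC⟩ ⟨C', hC'⟩
    refine ⟨C + C', ?_⟩
    calc (b + c) * K - K * (b + c) = (b * K - K * b) + (c * K - K * c) := by noncomm_ring
      _ = _ := by rw [hC, hC']; noncomm_ring
  algebraMap_mem' r := ⟨0, by rw [Algebra.commutes]; simp⟩
  star_mem' := by
    rintro b ⟨C, hC⟩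
    refine ⟨-star C, ?_⟩
    have := congrArg star hC
    simp only [star_sub, star_mul, hK.star_eq] at this
    rw [← neg_sub, this]; noncomm_ring

variable (e : HilbertBasis X ℂ H)

/-- The self-adjoint operator with eigenvalues `Λ p ≥ 1` on a Hilbert basis, and its properties. -/
theorem exists_diagonal_dirac (Λ : X → ℝ) (hΛ : ∀ p, 1 ≤ Λ p)
    (hlim : Filter.Tendsto Λ Filter.cofinite Filter.atTop) :
    ∃ (K : H →L[ℂ] H) (hK : Function.Injective K), IsSelfAdjoint K ∧
      (∀ p, K (e p) = (((Λ p)⁻¹ : ℝ) : ℂ) • e p) ∧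
      Dense ((invPMap K hK).domain : Set H) ∧ IsSelfAdjoint (invPMap K hK) ∧
      (∃ R : H →L[ℂ] H, IsInvOneAddSq (invPMap K hK) R ∧ IsCompactOperator R) ∧
      ∀ s : ℝ, 0 ≤ s → ((∃ R : H →L[ℂ] H, IsInvOneAddSq (invPMap K hK) R ∧
        HasFiniteTrace (R ^ s)) ↔ Summable fun p => ((1 + Λ p ^ 2)⁻¹) ^ s) := by
  have hpos : ∀ p, 0 < Λ p := fun p => one_pos.trans_le (hΛ p)
  obtain ⟨K, hK, -⟩ := e.exists_diag (fun p => (((Λ p)⁻¹ : ℝ) : ℂ)) 1 zero_le_one (fun p => by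
    rw [Complex.norm_real, Real.norm_of_nonneg (inv_nonneg.2 (hpos p).le)]
    exact inv_le_one_of_one_le₀ (hΛ p))
  obtain ⟨R, hR, -⟩ := e.exists_diag (fun p => (((1 + Λ p ^ 2)⁻¹ : ℝ) : ℂ)) 1 zero_le_one
    (fun p => by
      rw [Complex.norm_real, Real.norm_of_nonneg (by positivity)]
      exact inv_le_one_of_one_le₀ (by nlinarith [hpos p]))
  have hne : ∀ p, (Λ p : ℂ) ≠ 0 := fun p => Complex.ofReal_ne_zero.2 (hpos p).ne'
  have hsa := e.isSelfAdjoint_diag hK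
  have hinj : Function.Injective K := by
    rw [injective_iff_map_eq_zero]
    intro x hx
    refine e.repr.injective (Subtype.ext (funext fun p => ?_))
    have := e.repr_diag hK x p
    rw [hx, inner_zero_right, eq_comm, mul_eq_zero] at this
    rw [e.repr_apply_apply, this.resolve_left (by simpa using (hpos p).ne')]
    simp
  have hbasis : ∀ p, e p = K ((Λ p : ℂ) • e p) := fun p => by
    rw [map_smul, hK, smul_smul, Complex.ofReal_inv, mul_inv_cancel₀ (hne p), one_smul]
  have hd : Dense ((invPMap K hinj).domain : Set H) := by
    refine (Submodule.dense_iff_topologicalClosure_eq_top.2 e.dense_span).mono ?_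
    refine Submodule.span_le.2 ?_
    rintro _ ⟨p, rfl⟩
    exact ⟨_, (hbasis p).symm⟩
  have hne2 : ∀ p, (1 + (Λ p : ℂ) ^ 2) ≠ 0 := fun p => by
    have : (1 + Λ p ^ 2) ≠ 0 := by positivity
    exact_mod_cast this
  have hinv : IsInvOneAddSq (invPMap K hinj) R := by
    refine isInvOneAddSq_invPMap (e.clm_ext fun p => ?_) (e.clm_ext fun p => ?_) <;>
    · simp only [add_apply, mul_apply_eq_comp, hK, hR, map_smul, smul_smul,
        ← add_smul]
      congr 1
      push_cast
      field_simp [hne p, hne2 p]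
      ring
  refine ⟨K, hinj, hsa, hK, hd, isSelfAdjoint_invPMap hsa hd, ⟨R, hinv, ?_⟩, fun s hs => ?_⟩
  · refine e.isCompactOperator_of_tendsto ?_ hR
    have h1 : Filter.Tendsto (fun p => (1 + Λ p ^ 2)⁻¹) Filter.cofinite (nhds 0) :=
      (Filter.tendsto_atTop_add_const_left _ _
        ((Filter.tendsto_pow_atTop two_ne_zero).comp hlim)).inv_tendsto_atTop
    exact (Complex.continuous_ofReal.tendsto' 0 0 Complex.ofReal_zero).comp h1
  · have hc : ∀ p, 0 ≤ (1 + Λ p ^ 2)⁻¹ := fun p => by positivity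
    have key : ∀ R' : H →L[ℂ] H, (∀ p, R' (e p) = (((1 + Λ p ^ 2)⁻¹ : ℝ) : ℂ) • e p) →
        (HasFiniteTrace (R' ^ s) ↔ Summable fun p => ((1 + Λ p ^ 2)⁻¹) ^ s) := fun R' hR' =>
      e.hasFiniteTrace_diag_iff (fun p => Real.rpow_nonneg (hc p) s) (e.rpow_diag hc hR' hs)
    refine ⟨?_, fun h => ⟨R, hinv, (key R hR).2 h⟩⟩
    -- The operator `R'` is arbitrary, but being a left inverse of `1 + D²` on the eigenvectors `e
    -- p` already forces its diagonal form.
    rintro ⟨R', hR', ht⟩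
    refine (key R' fun p => ?_).1 ht
    have hm : e p ∈ (invPMap K hinj).domain := ⟨_, (hbasis p).symm⟩
    have hD : invPMap K hinj ⟨e p, hm⟩ = (Λ p : ℂ) • e p := invPMap_apply_of_eq (hbasis p) hm
    have hDm : (Λ p : ℂ) • e p = K ((Λ p : ℂ) ^ 2 • e p) := by
      rw [pow_two, mul_smul, map_smul, ← hbasis]
    have h2 := hR'.2 ⟨e p, hm⟩ (hD ▸ ⟨_, hDm.symm⟩)
    rw [invPMap_apply_of_eq (hD.trans hDm)] at h2
    change R' (e p + _) = e p at h2
    have h3 : e p + (Λ p : ℂ) ^ 2 • e p = (1 + (Λ p : ℂ) ^ 2) • e p := by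
      rw [add_smul, one_smul]
    rw [h3, map_smul] at h2
    nth_rewrite 2 [← h2]
    rw [smul_smul]
    push_cast
    rw [inv_mul_cancel₀ (hne2 p), one_smul]

end DiagonalDirac

/-! ### Amenability and weak containment, at the level of the group algebra. -/

section WeakContainment

variable {G : Type} [Group G]

/-- The extension of a unitary representation to the group algebra. -/
def UnitaryRep.alg (r : UnitaryRep G) : MonoidAlgebra ℂ G →ₐ[ℂ] (r.H →L[ℂ] r.H) :=
  MonoidAlgebra.lift ℂ _ G ((unitary (r.H →L[ℂ] r.H)).subtype.comp r.ρ)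

theorem UnitaryRep.alg_apply (r : UnitaryRep G) (f : MonoidAlgebra ℂ G) (x : r.H) :
    r.alg f x = ∑ g ∈ f.coeff.support, f.coeff g • (r.ρ g : r.H →L[ℂ] r.H) x := by
  rw [UnitaryRep.alg, MonoidAlgebra.lift_apply, Finsupp.sum, sum_apply]
  rfl

theorem UnitaryRep.inner_apply_apply (r : UnitaryRep G) (g h : G) (x y : r.H) :
    ⟪(r.ρ g : r.H →L[ℂ] r.H) x, (r.ρ h : r.H →L[ℂ] r.H) y⟫_ℂ =
      ⟪x, (r.ρ (g⁻¹ * h) : r.H →L[ℂ] r.H) y⟫_ℂ := by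
  rw [map_mul, map_inv, Submonoid.coe_mul, mul_apply_eq_comp, ← Unitary.star_eq_inv,
    Unitary.coe_star, ContinuousLinearMap.star_eq_adjoint,
    ContinuousLinearMap.adjoint_inner_right]

theorem UnitaryRep.norm_apply (r : UnitaryRep G) (g : G) (x : r.H) :
    ‖(r.ρ g : r.H →L[ℂ] r.H) x‖ = ‖x‖ := by
  have := r.inner_apply_apply g g x x
  rw [inv_mul_cancel, map_one, Submonoid.coe_one, one_apply_eq_self, inner_self_eq_norm_sq_to_K,
    inner_self_eq_norm_sq_to_K] at this
  have h2 : ‖(r.ρ g : r.H →L[ℂ] r.H) x‖ ^ 2 = ‖x‖ ^ 2 := by exact_mod_cast this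
  exact (pow_left_inj₀ (norm_nonneg _) (norm_nonneg _) two_ne_zero).1 h2

/-- Every finite part of the canonical trace of `G` is a sum of vector functionals of `r`. -/
def UnitaryRep.HasRegularCoefficients (r : UnitaryRep G) : Prop :=
  ∀ W : Finset G, ∃ (J : Type) (_ : Fintype J) (ζ : J → r.H), ∀ g ∈ W,
    ((g = 1 → ∑ j, ⟪ζ j, (r.ρ g : r.H →L[ℂ] r.H) (ζ j)⟫_ℂ = 1) ∧
      (g ≠ 1 → ∑ j, ⟪ζ j, (r.ρ g : r.H →L[ℂ] r.H) (ζ j)⟫_ℂ = 0))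

/-- Expanding the squares leaves the coefficients at `g⁻¹ * k`, and only `g = k` survives the sum
over `j`. Thus the vectors `ζ j` together see the `ℓ²` norm of `v`. -/
theorem UnitaryRep.sum_norm_sq_alg [DecidableEq G] (r : UnitaryRep G) {J : Type} [Fintype J]
    {ζ : J → r.H} (v : MonoidAlgebra ℂ G)
    (h : ∀ g ∈ v.coeff.support, ∀ k ∈ v.coeff.support,
      ∑ j, ⟪ζ j, (r.ρ (g⁻¹ * k) : r.H →L[ℂ] r.H) (ζ j)⟫_ℂ = if g⁻¹ * k = 1 then 1 else 0) :
    ∑ j, ‖r.alg v (ζ j)‖ ^ 2 = ∑ g ∈ v.coeff.support, ‖v.coeff g‖ ^ 2 := by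
  have key : ∑ j, ⟪r.alg v (ζ j), r.alg v (ζ j)⟫_ℂ =
      ∑ g ∈ v.coeff.support, (starRingEnd ℂ) (v.coeff g) * v.coeff g := by
    calc ∑ j, ⟪r.alg v (ζ j), r.alg v (ζ j)⟫_ℂ
        = ∑ j, ∑ g ∈ v.coeff.support, ∑ k ∈ v.coeff.support,
            (starRingEnd ℂ) (v.coeff g) * (v.coeff k *
              ⟪ζ j, (r.ρ (g⁻¹ * k) : r.H →L[ℂ] r.H) (ζ j)⟫_ℂ) := by
          refine Finset.sum_congr rfl fun j _ => ?_
          rw [r.alg_apply, sum_inner]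
          refine Finset.sum_congr rfl fun g _ => ?_
          rw [inner_sum]
          refine Finset.sum_congr rfl fun k _ => ?_
          rw [inner_smul_left, inner_smul_right, r.inner_apply_apply]
      _ = ∑ g ∈ v.coeff.support, ∑ k ∈ v.coeff.support,
            (starRingEnd ℂ) (v.coeff g) * (v.coeff k *
              ∑ j, ⟪ζ j, (r.ρ (g⁻¹ * k) : r.H →L[ℂ] r.H) (ζ j)⟫_ℂ) := by
          rw [Finset.sum_comm]
          refine Finset.sum_congr rfl fun g _ => ?_
          rw [Finset.sum_comm]
          refine Finset.sum_congr rfl fun k _ => ?_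
          rw [Finset.mul_sum, Finset.mul_sum]
      _ = _ := by
          refine Finset.sum_congr rfl fun g hg => ?_
          rw [Finset.sum_eq_single_of_mem g hg]
          · rw [h g hg g hg, if_pos (inv_mul_cancel g), mul_one]
          · intro k hk hkg
            rw [h g hg k hk, if_neg (fun h1 => hkg (inv_mul_eq_one.1 h1).symm)]
            simp
  have h1 : ∀ j, ⟪r.alg v (ζ j), r.alg v (ζ j)⟫_ℂ = ((‖r.alg v (ζ j)‖ ^ 2 : ℝ) : ℂ) := fun j => by
    rw [inner_self_eq_norm_sq_to_K]; norm_cast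
  simp only [h1, Complex.conj_mul'] at key
  exact_mod_cast key

/-- Left convolution by `f` on finitely supported functions is bounded by `‖r(f)‖` in `ℓ²`. -/
theorem UnitaryRep.sum_norm_sq_mul_le {r : UnitaryRep G} (hr : r.HasRegularCoefficients)
    (f v : MonoidAlgebra ℂ G) :
    ∑ g ∈ (f * v).coeff.support, ‖(f * v).coeff g‖ ^ 2 ≤
      ‖r.alg f‖ ^ 2 * ∑ g ∈ v.coeff.support, ‖v.coeff g‖ ^ 2 := by
  classical
  -- The same vectors must serve both `f * v` and `v`, so the finite set contains the quotients from
  -- both supports.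
  obtain ⟨J, _, ζ, hζ⟩ := hr
    (((f * v).coeff.support ×ˢ (f * v).coeff.support).image (fun q => q.1⁻¹ * q.2) ∪
      (v.coeff.support ×ˢ v.coeff.support).image (fun q => q.1⁻¹ * q.2))
  have hζ' := fun (g : G) hg => show _ = ite (g = 1) (1 : ℂ) 0 by
    split_ifs with h
    · exact (hζ g hg).1 h
    · exact (hζ g hg).2 h
  rw [← r.sum_norm_sq_alg (ζ := ζ) (f * v), ← r.sum_norm_sq_alg (ζ := ζ) v, Finset.mul_sum]
  · refine Finset.sum_le_sum fun j _ => ?_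
    rw [← mul_pow, map_mul]
    exact pow_le_pow_left₀ (norm_nonneg _) ((r.alg f).le_opNorm _) 2
  · exact fun g hg k hk => hζ' _ (Finset.mem_union_right _
      (Finset.mem_image.2 ⟨(g, k), Finset.mk_mem_product hg hk, rfl⟩))
  · exact fun g hg k hk => hζ' _ (Finset.mem_union_left _
      (Finset.mem_image.2 ⟨(g, k), Finset.mk_mem_product hg hk, rfl⟩))

variable (G) in
/-- Følner's condition. -/
def FolnerCondition [DecidableEq G] : Prop :=
  ∀ (S : Finset G) (ε : ℝ), 0 < ε → ∃ E V : Finset G, E.Nonempty ∧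
    (∀ s ∈ S, ∀ x ∈ E, s * x ∈ V) ∧ (V.card : ℝ) ≤ (1 + ε) * E.card

/-- A truncated form of Fell absorption. Convolving the function `g ↦ r'(g⁻¹) ξ`, cut off to `V`,
with `f` gives `k ↦ r'(k⁻¹) r'(f) ξ` on `E`. Both functions have constant norm because `r'` is
unitary, hence the two cardinalities. Coordinates in a basis of `r'.H` reduce this to the scalar
convolution bound. -/
theorem UnitaryRep.card_mul_norm_sq_le [DecidableEq G] {r : UnitaryRep G}
    (hr : r.HasRegularCoefficients) (r' : UnitaryRep G) (f : MonoidAlgebra ℂ G) (ξ : r'.H)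
    {E V : Finset G} (hEV : ∀ s ∈ f.coeff.support, ∀ x ∈ E, s⁻¹ * x ∈ V) :
    E.card * ‖r'.alg f ξ‖ ^ 2 ≤ ‖r.alg f‖ ^ 2 * (V.card * ‖ξ‖ ^ 2) := by
  obtain ⟨w, b, -⟩ := exists_hilbertBasis ℂ r'.H
  let v : w → MonoidAlgebra ℂ G := fun i =>
    ∑ g ∈ V, MonoidAlgebra.single g ⟪b i, (r'.ρ g⁻¹ : r'.H →L[ℂ] r'.H) ξ⟫_ℂ
  have hv : ∀ i g, (v i).coeff g =
      if g ∈ V then ⟪b i, (r'.ρ g⁻¹ : r'.H →L[ℂ] r'.H) ξ⟫_ℂ else 0 := by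
    intro i g
    simp [v, MonoidAlgebra.coeff_sum, Finsupp.single_apply]
  have hfv : ∀ i, ∀ k ∈ E, (f * v i).coeff k =
      ⟪b i, (r'.ρ k⁻¹ : r'.H →L[ℂ] r'.H) (r'.alg f ξ)⟫_ℂ := by
    intro i k hk
    rw [MonoidAlgebra.coeff_mul_apply_left, Finsupp.sum, r'.alg_apply, map_sum, inner_sum]
    refine Finset.sum_congr rfl fun h hh => ?_
    rw [hv, if_pos (hEV h hh k hk), map_smul, inner_smul_right, ← mul_apply_eq_comp,
      ← Submonoid.coe_mul, ← map_mul, mul_inv_rev, inv_inv]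
  have hle : ∀ i, ∑ k ∈ E, ‖⟪b i, (r'.ρ k⁻¹ : r'.H →L[ℂ] r'.H) (r'.alg f ξ)⟫_ℂ‖ ^ 2 ≤
      ‖r.alg f‖ ^ 2 * ∑ g ∈ V, ‖⟪b i, (r'.ρ g⁻¹ : r'.H →L[ℂ] r'.H) ξ⟫_ℂ‖ ^ 2 := by
    intro i
    calc _ = ∑ k ∈ E, ‖(f * v i).coeff k‖ ^ 2 :=
          Finset.sum_congr rfl fun k hk => by rw [hfv i k hk]
      _ ≤ ∑ k ∈ (f * v i).coeff.support, ‖(f * v i).coeff k‖ ^ 2 := by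
          rw [← Finset.sum_filter_ne_zero]
          refine Finset.sum_le_sum_of_subset_of_nonneg (fun k hk => ?_) fun _ _ _ => by positivity
          rw [Finsupp.mem_support_iff]
          rintro h
          simp [h] at hk
      _ ≤ _ := UnitaryRep.sum_norm_sq_mul_le hr f (v i)
      _ ≤ ‖r.alg f‖ ^ 2 * ∑ g ∈ V, ‖(v i).coeff g‖ ^ 2 := by
          gcongr
          intro k hk
          by_contra h
          simp [hv, h] at hk
      _ = _ := by
          congr 1
          exact Finset.sum_congr rfl fun g hg => by rw [hv, if_pos hg]
  have h1 : HasSum (fun i => ∑ k ∈ E, ‖⟪b i, (r'.ρ k⁻¹ : r'.H →L[ℂ] r'.H) (r'.alg f ξ)⟫_ℂ‖ ^ 2)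
      (∑ k ∈ E, ‖r'.alg f ξ‖ ^ 2) := by
    refine hasSum_sum fun k _ => ?_
    simpa only [r'.norm_apply] using
      b.hasSum_norm_sq ((r'.ρ k⁻¹ : r'.H →L[ℂ] r'.H) (r'.alg f ξ))
  have h2 : HasSum (fun i => ‖r.alg f‖ ^ 2 *
      ∑ g ∈ V, ‖⟪b i, (r'.ρ g⁻¹ : r'.H →L[ℂ] r'.H) ξ⟫_ℂ‖ ^ 2)
      (‖r.alg f‖ ^ 2 * ∑ k ∈ V, ‖ξ‖ ^ 2) := by
    refine (hasSum_sum fun k _ => ?_).mul_left _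
    simpa only [r'.norm_apply] using b.hasSum_norm_sq ((r'.ρ k⁻¹ : r'.H →L[ℂ] r'.H) ξ)
  have := hasSum_le hle h1 h2
  simpa only [Finset.sum_const, nsmul_eq_mul] using this

/-- For an amenable group, a representation that weakly contains the regular representation
weakly contains every representation. -/
theorem UnitaryRep.norm_alg_le [DecidableEq G] (hG : FolnerCondition G) {r : UnitaryRep G}
    (hr : r.HasRegularCoefficients) (r' : UnitaryRep G) (f : MonoidAlgebra ℂ G) :
    ‖r'.alg f‖ ≤ ‖r.alg f‖ := by
  refine ContinuousLinearMap.opNorm_le_bound _ (norm_nonneg _) fun ξ => ?_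
  have key : ∀ ε : ℝ, 0 < ε →
      ‖r'.alg f ξ‖ ^ 2 ≤ (1 + ε) * (‖r.alg f‖ * ‖ξ‖) ^ 2 := by
    intro ε hε
    -- The support is inverted because convolution by `f` evaluates at `s⁻¹ * x`.
    obtain ⟨E, V, hE, hEV, hc⟩ := hG (f.coeff.support.image (·⁻¹)) ε hε
    have h := UnitaryRep.card_mul_norm_sq_le hr r' f ξ (E := E) (V := V) fun s hs x hx =>
      hEV _ (Finset.mem_image_of_mem _ hs) x hx
    have hpos : (0 : ℝ) < E.card := by exact_mod_cast hE.card_pos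
    refine le_of_mul_le_mul_left ?_ hpos
    calc _ ≤ _ := h
      _ = V.card * (‖r.alg f‖ * ‖ξ‖) ^ 2 := by ring
      _ ≤ ((1 + ε) * E.card) * (‖r.alg f‖ * ‖ξ‖) ^ 2 := by gcongr
      _ = _ := by ring
  have hlim : ‖r'.alg f ξ‖ ^ 2 ≤ (‖r.alg f‖ * ‖ξ‖) ^ 2 := by
    refine ge_of_tendsto (x := nhdsWithin (0 : ℝ) (Set.Ioi 0))
      (f := fun ε => (1 + ε) * (‖r.alg f‖ * ‖ξ‖) ^ 2) ?_
      (eventually_nhdsWithin_of_forall key)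
    have : Filter.Tendsto (fun ε : ℝ => (1 + ε) * (‖r.alg f‖ * ‖ξ‖) ^ 2) (nhds 0)
        (nhds ((1 + 0) * (‖r.alg f‖ * ‖ξ‖) ^ 2)) :=
      (Continuous.tendsto (by fun_prop) 0)
    rw [add_zero, one_mul] at this
    exact this.mono_left nhdsWithin_le_nhds
  exact (pow_le_pow_iff_left₀ (norm_nonneg _) (by positivity) two_ne_zero).1 hlim

end WeakContainment

/-! ### Evaluation of `C*(G)` at a single representation, and when it is faithful. -/

section Evaluation

variable {G : Type} [Group G]

/-- Evaluation at a unitary representation, as a representation of `C*(G)`. -/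
def UnitaryRep.toCStar (r : UnitaryRep G) : GroupCStar G →⋆ₐ[ℂ] (r.H →L[ℂ] r.H) where
  toFun x := (x : RepFamilies G) r
  map_one' := rfl
  map_mul' _ _ := rfl
  map_zero' := rfl
  map_add' _ _ := rfl
  commutes' _ := rfl
  map_star' _ := rfl

theorem UnitaryRep.toCStar_of (r : UnitaryRep G) (g : G) :
    r.toCStar (GroupCStar.of g) = (r.ρ g : r.H →L[ℂ] r.H) := rfl

theorem univRep_mul (g h : G) : univRep (g * h) = univRep g * univRep h := by
  ext r : 2
  change ((r.ρ (g * h) : unitary _) : r.H →L[ℂ] r.H) = _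
  rw [map_mul]; rfl

theorem univRep_inv (g : G) : univRep g⁻¹ = star (univRep g) := by
  ext r : 2
  change ((r.ρ g⁻¹ : unitary _) : r.H →L[ℂ] r.H) = _
  rw [map_inv]; rfl

theorem univRep_one : univRep (1 : G) = 1 := by
  ext r : 2
  change ((r.ρ 1 : unitary _) : r.H →L[ℂ] r.H) = _
  rw [map_one]; rfl

/-- The image of `G` is closed under products and adjoints, so the star-algebra it generates is its
linear span. One `f` serves all `r` at once, which makes norms in different representations
comparable. -/
theorem exists_alg_eq_of_mem_adjoin {x : RepFamilies G}
    (hx : x ∈ StarAlgebra.adjoin ℂ (Set.range (univRep (G := G)))) :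
    ∃ f : MonoidAlgebra ℂ G, ∀ r : UnitaryRep G, x r = r.alg f := by
  have hx' : x ∈ Subalgebra.toSubmodule
      (StarAlgebra.adjoin ℂ (Set.range (univRep (G := G)))).toSubalgebra := hx
  have hstar : star (Set.range (univRep (G := G))) ⊆ Set.range (univRep (G := G)) := by
    rintro y ⟨g, hg⟩
    exact ⟨g⁻¹, by rw [univRep_inv, hg, star_star]⟩
  rw [StarAlgebra.adjoin_eq_span, Set.union_eq_self_of_subset_right hstar] at hx'
  have hcl : ∀ y ∈ Submonoid.closure (Set.range (univRep (G := G))), ∃ g : G, univRep g = y := by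
    intro y hy
    induction hy using Submonoid.closure_induction with
    | mem y hy => exact hy
    | one => exact ⟨1, univRep_one⟩
    | mul y z _ _ hy hz =>
      obtain ⟨g, rfl⟩ := hy
      obtain ⟨h, rfl⟩ := hz
      exact ⟨g * h, univRep_mul g h⟩
  clear hx
  induction hx' using Submodule.span_induction with
  | mem y hy =>
    obtain ⟨g, rfl⟩ := hcl y hy
    refine ⟨MonoidAlgebra.single g 1, fun r => ?_⟩
    rw [UnitaryRep.alg, MonoidAlgebra.lift_single, one_smul]
    rfl
  | zero => exact ⟨0, fun r => by rw [map_zero]; rfl⟩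
  | add y z _ _ hy hz =>
    obtain ⟨f, hf⟩ := hy
    obtain ⟨f', hf'⟩ := hz
    exact ⟨f + f', fun r => by rw [map_add, ← hf, ← hf']; rfl⟩
  | smul c y _ hy =>
    obtain ⟨f, hf⟩ := hy
    exact ⟨c • f, fun r => by rw [map_smul, ← hf]; rfl⟩

/-- For an amenable group, evaluation at a representation that weakly contains the regular
representation is a faithful representation of the full group C*-algebra. -/
theorem UnitaryRep.toCStar_injective [DecidableEq G] (hG : FolnerCondition G) {r : UnitaryRep G}
    (hr : r.HasRegularCoefficients) : Function.Injective r.toCStar := by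
  have hle : ∀ x : RepFamilies G,
      x ∈ (StarAlgebra.adjoin ℂ (Set.range (univRep (G := G)))).topologicalClosure →
      ‖x‖ ≤ ‖x r‖ := by
    intro x hx
    -- The inequality passes to norm limits, so weak containment on the group algebra suffices.
    have hclosed : IsClosed {x : RepFamilies G | ‖x‖ ≤ ‖x r‖} := by
      refine isClosed_le continuous_norm (Continuous.norm ?_)
      refine LipschitzWith.continuous (K := 1) (LipschitzWith.of_dist_le_mul fun x y => ?_)
      rw [dist_eq_norm, dist_eq_norm, NNReal.coe_one, one_mul]
      exact lp.norm_apply_le_norm ENNReal.top_ne_zero (x - y) r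
    refine closure_minimal (fun y hy => ?_) hclosed hx
    obtain ⟨f, hf⟩ := exists_alg_eq_of_mem_adjoin hy
    refine lp.norm_le_of_forall_le (norm_nonneg _) fun r' => ?_
    rw [hf, hf]
    exact UnitaryRep.norm_alg_le hG hr r' f
  rw [injective_iff_map_eq_zero]
  rintro ⟨x, hx⟩ h
  have := hle x hx
  have h0 : x r = 0 := h
  rw [h0, norm_zero] at this
  exact Subtype.ext (norm_le_zero_iff.1 this)

theorem groupAlg_dense : Dense (groupAlg G : Set (GroupCStar G)) := by
  have hmap : (groupAlg G).map (StarSubalgebra.subtype _) =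
      StarAlgebra.adjoin ℂ (Set.range (univRep (G := G))) := by
    rw [groupAlg, StarAlgHom.map_adjoin, ← Set.range_comp]
    rfl
  rintro ⟨x, hx⟩
  rw [Topology.IsInducing.subtypeVal.closure_eq_preimage_closure_image]
  change x ∈ closure _
  have : (Subtype.val '' (groupAlg G : Set (GroupCStar G))) =
      (StarAlgebra.adjoin ℂ (Set.range (univRep (G := G))) : Set (RepFamilies G)) :=
    congrArg (fun S : StarSubalgebra ℂ (RepFamilies G) => (S : Set (RepFamilies G))) hmap
  exact this ▸ hx

theorem UnitaryRep.continuous_toCStar (r : UnitaryRep G) : Continuous r.toCStar :=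
  AddMonoidHomClass.continuous_of_bound r.toCStar 1 fun x => by
    rw [one_mul]
    exact lp.norm_apply_le_norm ENNReal.top_ne_zero (x : RepFamilies G) r

/-- A star-subalgebra containing the image of `G` contains the image of the group algebra. -/
theorem UnitaryRep.toCStar_mem (r : UnitaryRep G) (S : StarSubalgebra ℂ (r.H →L[ℂ] r.H))
    (hS : ∀ g, (r.ρ g : r.H →L[ℂ] r.H) ∈ S) {x : GroupCStar G} (hx : x ∈ groupAlg G) :
    r.toCStar x ∈ S := by
  have : groupAlg G ≤ S.comap r.toCStar := by
    refine StarAlgebra.adjoin_le ?_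
    rintro _ ⟨g, rfl⟩
    exact hS g
  exact this hx

end Evaluation

/-! ### Følner sets in abelian groups and in `G_a`. -/

section Folner

-- Elements of the `k`-fold sumset are combinations of `T` with coefficients in `{0, …, k}`, so its
-- growth is polynomial in `k`.
open scoped Pointwise in
theorem card_nsmul_le_pow {A : Type*} [AddCommGroup A] [DecidableEq A] (T : Finset A) (k : ℕ) :
    (k • T).card ≤ (k + 1) ^ T.card := by
  have key : ∀ k : ℕ, ∀ x ∈ k • T, ∃ c : A → ℕ, (∀ t, c t ≤ k) ∧ x = ∑ t ∈ T, c t • t := by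
    intro k
    induction k with
    | zero =>
      intro x hx
      rw [zero_nsmul, Finset.mem_zero] at hx
      exact ⟨0, fun _ => le_rfl, by simp [hx]⟩
    | succ k ih =>
      intro x hx
      rw [succ_nsmul, Finset.mem_add] at hx
      obtain ⟨y, hy, t, ht, rfl⟩ := hx
      obtain ⟨c, hc, rfl⟩ := ih y hy
      refine ⟨fun s => c s + if s = t then 1 else 0, fun s => ?_, ?_⟩
      · have := hc s
        dsimp only
        split_ifs <;> omega
      · simp [add_smul, Finset.sum_add_distrib, ite_smul, ht]
  calc (k • T).card
      ≤ ((Fintype.piFinset fun _ : T => Finset.range (k + 1)).image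
          fun c => ∑ t : T, c t • (t : A)).card := by
        refine Finset.card_le_card fun x hx => ?_
        obtain ⟨c, hc, rfl⟩ := key k x hx
        refine Finset.mem_image.2 ⟨fun t => c t, ?_, ?_⟩
        · simp [Fintype.mem_piFinset, hc]
        · exact Finset.sum_coe_sort T fun t => c t • t
    _ ≤ _ := Finset.card_image_le
    _ = _ := by simp

open scoped Pointwise in
/-- Abelian groups are amenable. -/
theorem exists_card_add_le {A : Type*} [AddCommGroup A] [DecidableEq A] (T : Finset A) {ε : ℝ}
    (hε : 0 < ε) : ∃ E : Finset A, E.Nonempty ∧ ((T + E).card : ℝ) ≤ (1 + ε) * E.card := by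
  rcases T.eq_empty_or_nonempty with rfl | hT
  · exact ⟨{0}, by simp, by simp; positivity⟩
  -- Otherwise the sumsets `k • T` would grow at least like `(1 + ε) ^ k`, against the polynomial
  -- bound.
  by_contra! h
  have hne : ∀ k : ℕ, (k • T).Nonempty := by
    intro k
    induction k with
    | zero => simp
    | succ k ih => rw [succ_nsmul]; exact ih.add hT
  have hgrow : ∀ k : ℕ, (1 + ε) ^ k ≤ ((k • T).card : ℝ) := by
    intro k
    induction k with
    | zero => simp
    | succ k ih =>
      have := h _ (hne k)
      rw [add_comm T, ← succ_nsmul] at this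
      calc (1 + ε) ^ (k + 1) = (1 + ε) * (1 + ε) ^ k := pow_succ' _ _
        _ ≤ (1 + ε) * (k • T).card := by gcongr
        _ ≤ _ := this.le
  have hlim := (tendsto_pow_const_div_const_pow_of_one_lt T.card
    (show (1 : ℝ) < 1 + ε by linarith)).comp (Filter.tendsto_add_atTop_nat 1)
  have hev := hlim.eventually_lt_const (show (0 : ℝ) < (1 + ε)⁻¹ by positivity)
  obtain ⟨k, hk⟩ := hev.exists
  have h1 : ((k • T).card : ℝ) ≤ ((k + 1 : ℕ) : ℝ) ^ T.card := by
    exact_mod_cast card_nsmul_le_pow T k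
  simp only [Function.comp] at hk
  rw [div_lt_iff₀ (by positivity), pow_succ, mul_comm ((1 + ε) ^ k), ← mul_assoc,
    inv_mul_cancel₀ (by positivity), one_mul] at hk
  linarith [hgrow k]

variable {a : ℝ} (ha : 0 < a)

theorem scale_scale (m n : ℤ) (b : Bgrp a) : scale ha m (scale ha n b) = scale ha (m + n) b := by
  ext
  simp [scale, zpow_add₀ ha.ne', mul_assoc]

theorem scale_zero (b : Bgrp a) : scale ha 0 b = b := by
  ext; simp [scale]

/-- The element `u ^ n * b` of `G_a`. -/
def Ggrp.mk' (n : ℤ) (b : Bgrp a) : Ggrp ha :=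
  ⟨Multiplicative.ofAdd (scale ha n b), Multiplicative.ofAdd n⟩

theorem Ggrp.mk'_injective {n m : ℤ} {b c : Bgrp a} (h : Ggrp.mk' ha n b = Ggrp.mk' ha m c) :
    n = m ∧ b = c := by
  have h2 : n = m := congrArg (fun g : Ggrp ha => g.right.toAdd) h
  subst h2
  have h1 : scale ha n b = scale ha n c := congrArg (fun g : Ggrp ha => g.left.toAdd) h
  exact ⟨rfl, (scale ha n).injective h1⟩

theorem Ggrp.mul_mk' (g : Ggrp ha) (n : ℤ) (b : Bgrp a) :
    g * Ggrp.mk' ha n b = Ggrp.mk' ha (g.right.toAdd + n)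
      (scale ha (-(g.right.toAdd + n)) g.left.toAdd + b) := by
  refine SemidirectProduct.ext ?_ rfl
  change g.left * Multiplicative.ofAdd (scale ha g.right.toAdd (scale ha n b)) =
    Multiplicative.ofAdd (scale ha (g.right.toAdd + n) (scale ha _ _ + b))
  rw [map_add, scale_scale, scale_scale, add_neg_cancel, scale_zero]
  rfl

-- The Følner set consists of the `u ^ n * b` with `0 ≤ n < N` and `b ∈ E'`. Left multiplication by
-- `(c, l)` shifts `n` by `l` and translates `b` by `a ^ (-(n + l)) * c`. Once `N` is fixed only
-- finitely many such translations occur, and `E'` is chosen almost invariant under all of them.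
open scoped Pointwise in
theorem Ggrp.folnerCondition [DecidableEq (Ggrp ha)] : FolnerCondition (Ggrp ha) := by
  classical
  intro S ε hε
  obtain ⟨L, hL⟩ : ∃ L : ℕ, ∀ s ∈ S, |s.right.toAdd| ≤ (L : ℤ) := by
    refine ⟨S.sup fun s => s.right.toAdd.natAbs, fun s hs => ?_⟩
    rw [Int.abs_eq_natAbs]
    exact_mod_cast Finset.le_sup (f := fun s : Ggrp ha => s.right.toAdd.natAbs) hs
  obtain ⟨δ, hδ, hδε⟩ : ∃ δ : ℝ, 0 < δ ∧ (1 + δ) * (1 + δ) ≤ 1 + ε := by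
    -- For `δ ≤ 1` one has `(1 + δ)² ≤ 1 + 3 δ`.
    refine ⟨min 1 (ε / 3), by positivity, ?_⟩
    have h1 := min_le_left 1 (ε / 3)
    have h2 := min_le_right 1 (ε / 3)
    have h3 : 0 < min 1 (ε / 3) := by positivity
    nlinarith
  -- This makes the enlarged interval, of length `N + 2 L`, at most `(1 + δ) N` long.
  obtain ⟨N, hN⟩ := exists_nat_gt (2 * L / δ)
  have hN0 : 0 < N := by
    have : (0 : ℝ) < N := lt_of_le_of_lt (by positivity) hN
    exact_mod_cast this
  rw [div_lt_iff₀ hδ] at hN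
  let I : Finset ℤ := Finset.Ico (-(L : ℤ)) (N + L)
  let T : Finset (Bgrp a) := (I ×ˢ S).image fun q => scale ha (-q.1) q.2.left.toAdd
  obtain ⟨E', hE', hc⟩ := exists_card_add_le T hδ
  refine ⟨(Finset.range N ×ˢ E').image fun q => Ggrp.mk' ha q.1 q.2,
    (I ×ˢ (T + E')).image fun q => Ggrp.mk' ha q.1 q.2, ?_, ?_, ?_⟩
  · exact ((Finset.nonempty_range_iff.2 hN0.ne').product hE').image _
  · intro s hs x hx
    obtain ⟨⟨n, e⟩, hne, rfl⟩ := Finset.mem_image.1 hx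
    obtain ⟨hn, he⟩ := Finset.mem_product.1 hne
    have hn' : n < N := Finset.mem_range.1 hn
    have hI : s.right.toAdd + n ∈ I := by
      have := abs_le.1 (hL s hs)
      rw [Finset.mem_Ico]
      omega
    rw [Ggrp.mul_mk']
    refine Finset.mem_image.2 ⟨(_, _), Finset.mk_mem_product hI (Finset.add_mem_add ?_ he), rfl⟩
    exact Finset.mem_image.2 ⟨(_, s), Finset.mk_mem_product hI hs, rfl⟩
  · have h1 : (((Finset.range N ×ˢ E').image fun q : ℕ × Bgrp a =>
        Ggrp.mk' ha q.1 q.2).card : ℝ) = N * E'.card := by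
      rw [Finset.card_image_of_injective, Finset.card_product, Finset.card_range, Nat.cast_mul]
      rintro ⟨n, b⟩ ⟨m, c⟩ h
      obtain ⟨h1, h2⟩ := Ggrp.mk'_injective ha h
      exact Prod.ext (by exact_mod_cast h1) h2
    have h2 : (((I ×ˢ (T + E')).image fun q => Ggrp.mk' ha q.1 q.2).card : ℝ) ≤
        (N + 2 * L) * (T + E').card := by
      have h3 : I.card = N + 2 * L := by
        rw [Int.card_Ico]; omega
      have h4 := Finset.card_image_le (s := I ×ˢ (T + E')) (f := fun q => Ggrp.mk' ha q.1 q.2)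
      rw [Finset.card_product, h3] at h4
      exact_mod_cast h4
    rw [h1]
    calc _ ≤ _ := h2
      _ ≤ ((1 + δ) * N) * ((1 + δ) * E'.card) := by
          gcongr
          linarith
      _ = ((1 + δ) * (1 + δ)) * (N * E'.card) := by ring
      _ ≤ _ := by gcongr

end Folner

/-! ### Finite quotients of the ring `ℤ[a, a⁻¹]`. -/

section Characters

variable (a : ℝ)

/-- The ring `ℤ[a, a⁻¹]`. -/
abbrev laurentRing : Subalgebra ℤ ℝ := Algebra.adjoin ℤ ({a, a⁻¹} : Set ℝ)

instance : Algebra.FiniteType ℤ (laurentRing a) :=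
  Algebra.FiniteType.adjoin_of_finite (Set.toFinite _)

instance : IsNoetherianRing (laurentRing a) :=
  Algebra.FiniteType.isNoetherianRing ℤ _

theorem zpow_mem_laurentRing (n : ℤ) : a ^ n ∈ laurentRing a := by
  have h1 : a ∈ laurentRing a := Algebra.subset_adjoin (by simp)
  have h2 : a⁻¹ ∈ laurentRing a := Algebra.subset_adjoin (by simp)
  obtain ⟨k, rfl | rfl⟩ := n.eq_nat_or_neg
  · rw [zpow_natCast]; exact pow_mem h1 k
  · rw [zpow_neg, zpow_natCast, ← inv_pow]; exact pow_mem h2 k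

theorem Bgrp_le_laurentRing : Bgrp a ≤ (laurentRing a).toSubring.toAddSubgroup := by
  refine (AddSubgroup.closure_le _).2 ?_
  rintro _ ⟨n, rfl⟩
  exact zpow_mem_laurentRing a n

/-- The inclusion of `B_a` into `ℤ[a, a⁻¹]`. -/
def toLaurentRing : Bgrp a →+ laurentRing a :=
  AddSubgroup.inclusion (Bgrp_le_laurentRing a)

theorem toLaurentRing_injective : Function.Injective (toLaurentRing a) :=
  AddSubgroup.inclusion_injective _

/-- `a ^ n` as an element of `ℤ[a, a⁻¹]`. -/
def aPow (n : ℤ) : laurentRing a := ⟨a ^ n, zpow_mem_laurentRing a n⟩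

theorem toLaurentRing_scale {a : ℝ} (ha : 0 < a) (n : ℤ) (b : Bgrp a) :
    toLaurentRing a (scale ha n b) = aPow a n * toLaurentRing a b := rfl

instance : IsJacobsonRing ℤ := by
  refine isJacobsonRing_iff_prime_eq.2 fun P hP => ?_
  by_cases h : P = ⊥
  · subst h
    refine le_antisymm (fun x hx => ?_) Ideal.le_jacobson
    -- Membership in the Jacobson radical makes `x * y + 1` a unit for all `y`; taking `y = x`
    -- leaves only `x = 0`.
    have := Int.isUnit_iff.1 (Ideal.mem_jacobson_bot.1 hx x)
    rw [Ideal.mem_bot]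
    rcases this with h | h
    · exact mul_self_eq_zero.1 (by linarith)
    · nlinarith [mul_self_nonneg x]
  · have := hP.isMaximal h
    exact Ideal.jacobson_eq_self_of_isMaximal

/-- A field of finite type over `ℤ` is finite. -/
theorem IsField.finite_of_finiteType_int {F : Type*} [CommRing F] (hF : IsField F)
    (hfg : (Int.castRingHom F).FiniteType) : Finite F := by
  let _ : Field F := hF.toField
  have : Algebra.FiniteType ℤ F := RingHom.finiteType_algebraMap.1 hfg
  -- The Nullstellensatz over the Jacobson ring `ℤ`. In characteristic zero, integrality would then
  -- make `ℤ` itself a field.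
  have hfin : Module.Finite ℤ F := finite_of_finite_type_of_isJacobsonRing ℤ F
  obtain ⟨p, hp⟩ := CharP.exists F
  rcases CharP.char_is_prime_or_zero F p with h | h
  · have := Fact.mk h
    let _ : Algebra (ZMod p) F := ZMod.algebra F p
    have : Module.Finite (ZMod p) F := Module.Finite.of_restrictScalars_finite ℤ (ZMod p) F
    exact Module.finite_of_finite (ZMod p)
  · subst h
    have : CharZero F := CharP.charP_to_charZero F
    have hinj : Function.Injective (algebraMap ℤ F) := fun x y h => by simpa using h
    exact absurd (isField_of_isIntegral_of_isField hinj hF) Int.not_isField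

/-- The ring `ℤ[a, a⁻¹]` has an ideal with finite quotients by its powers, which intersect in `0`. -/
theorem exists_ideal_finite_quotient_pow : ∃ m : Ideal (laurentRing a),
    (∀ n, Finite (laurentRing a ⧸ m ^ n)) ∧ ⨅ n : ℕ, m ^ n = ⊥ := by
  -- Any maximal ideal works: its residue field is finite, and Krull's theorem handles the
  -- intersection.
  obtain ⟨m, hm⟩ := Ideal.exists_maximal (laurentRing a)
  refine ⟨m, fun n => ?_, Ideal.iInf_pow_eq_bot_of_isDomain m hm.ne_top⟩
  have : Algebra.FiniteType ℤ (laurentRing a ⧸ m) :=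
    Algebra.FiniteType.of_surjective (Ideal.Quotient.mkₐ ℤ m) Ideal.Quotient.mk_surjective
  have : Finite (laurentRing a ⧸ m) :=
    ((Ideal.Quotient.maximal_ideal_iff_isField_quotient m).1 hm).finite_of_finiteType_int
      (RingHom.ext_int (algebraMap ℤ (laurentRing a ⧸ m)) (Int.castRingHom _) ▸
        RingHom.finiteType_algebraMap.2 this)
  exact Ideal.finite_quotient_pow (IsNoetherian.noetherian m) n

end Characters

/-! ### Unitaries that permute a basis up to phases. -/

section Monomial

variable {X H : Type} [NormedAddCommGroup H] [InnerProductSpace ℂ H]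

theorem HilbertBasis.orthonormal_monomial (e : HilbertBasis X ℂ H) (σ : Equiv.Perm X)
    (c : X → Circle) : Orthonormal ℂ fun p => (c p : ℂ) • e (σ p) := by
  classical
  rw [orthonormal_iff_ite]
  intro p q
  rw [inner_smul_left, inner_smul_right, e.inner_eq_ite]
  by_cases h : p = q
  · subst h
    rw [if_pos rfl, if_pos rfl, mul_one, Complex.conj_mul', Circle.norm_coe]
    simp
  · simp [h]

variable [CompleteSpace H]

/-- The unitary operator that permutes a Hilbert basis up to phases. -/
def HilbertBasis.monomial (e : HilbertBasis X ℂ H) (σ : Equiv.Perm X) (c : X → Circle) :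
    unitary (H →L[ℂ] H) :=
  Unitary.linearIsometryEquiv.symm (e.repr.trans (HilbertBasis.mk (e.orthonormal_monomial σ c) (by
    rw [← e.dense_span]
    refine Submodule.topologicalClosure_mono (Submodule.span_le.2 ?_)
    rintro _ ⟨p, rfl⟩
    have h : (c (σ.symm p) : ℂ)⁻¹ • ((c (σ.symm p) : ℂ) • e (σ (σ.symm p))) = e p := by
      rw [inv_smul_smul₀ (Circle.coe_ne_zero _), Equiv.apply_symm_apply]
    rw [← h]
    exact Submodule.smul_mem _ _ (Submodule.subset_span ⟨_, rfl⟩))).repr.symm)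

theorem HilbertBasis.monomial_apply (e : HilbertBasis X ℂ H) (σ : Equiv.Perm X) (c : X → Circle)
    (p : X) : (e.monomial σ c : H →L[ℂ] H) (e p) = (c p : ℂ) • e (σ p) := by
  classical
  rw [HilbertBasis.monomial, Unitary.coe_symm_linearIsometryEquiv_apply]
  change LinearIsometryEquiv.symm _ (e.repr (e p)) = _
  rw [e.repr_self, HilbertBasis.repr_symm_single, HilbertBasis.coe_mk]

theorem HilbertBasis.unitary_ext (e : HilbertBasis X ℂ H) {A B : unitary (H →L[ℂ] H)}
    (h : ∀ p, (A : H →L[ℂ] H) (e p) = (B : H →L[ℂ] H) (e p)) : A = B :=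
  Subtype.ext (e.clm_ext h)

end Monomial

/-! ### Residues modulo the period. -/

section FinOfInt

/-- The residue of an integer modulo `q > 0`, as an element of `Fin q`. -/
def finOfInt {q : ℕ} (hq : 0 < q) (s : ℤ) : Fin q :=
  ⟨(s % q).toNat, by
    have := Int.emod_lt_of_pos s (Int.natCast_pos.2 hq)
    have := Int.emod_nonneg s (Int.natCast_pos.2 hq).ne'
    omega⟩

theorem coe_finOfInt {q : ℕ} (hq : 0 < q) (s : ℤ) : ((finOfInt hq s : ℕ) : ℤ) = s % q :=
  Int.toNat_of_nonneg (Int.emod_nonneg s (Int.natCast_pos.2 hq).ne')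

theorem finOfInt_congr {q : ℕ} (hq : 0 < q) {s t : ℤ} (h : s % q = t % q) :
    finOfInt hq s = finOfInt hq t :=
  Fin.ext (congrArg Int.toNat h)

theorem finOfInt_coe {q : ℕ} (hq : 0 < q) (s : Fin q) : finOfInt hq (s : ℕ) = s := by
  refine Fin.ext ?_
  have := coe_finOfInt hq (s : ℕ)
  rw [Int.emod_eq_of_lt (by positivity) (by exact_mod_cast s.2)] at this
  exact_mod_cast this

/-- The cyclic permutation `s ↦ s - 1`. -/
def cyclicPred {q : ℕ} (hq : 0 < q) : Equiv.Perm (Fin q) where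
  toFun s := finOfInt hq ((s : ℕ) - 1)
  invFun s := finOfInt hq ((s : ℕ) + 1)
  left_inv s := by
    refine Eq.trans (finOfInt_congr hq ?_) (finOfInt_coe hq s)
    rw [coe_finOfInt, Int.emod_add_emod, sub_add_cancel]
  right_inv s := by
    refine Eq.trans (finOfInt_congr hq ?_) (finOfInt_coe hq s)
    rw [coe_finOfInt, Int.emod_sub_emod, add_sub_cancel_right]

end FinOfInt

/-! ### Construction of the direct sum of the `π_{x,χ}`. -/

section PeriodicRep

variable {a : ℝ} (ha : 0 < a)

theorem dualMap_iterate (k : ℕ) (χ : AddChar (Bgrp a) Circle) (b : Bgrp a) :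
    (dualMap ha)^[k] χ b = χ (scale ha k b) := by
  induction k generalizing χ b with
  | zero => rw [Function.iterate_zero, id, Nat.cast_zero, scale_zero]
  | succ k ih =>
    rw [Function.iterate_succ, Function.comp, ih]
    change χ (scale ha 1 (scale ha k b)) = _
    rw [scale_scale, Nat.cast_succ, add_comm]

theorem apply_scale_mul_of_period {q : ℕ} {χ : AddChar (Bgrp a) Circle}
    (h : (dualMap ha)^[q] χ = χ) (k : ℤ) (b : Bgrp a) : χ (scale ha (q * k) b) = χ b := by
  have h1 : ∀ b, χ (scale ha q b) = χ b := fun b => by rw [← dualMap_iterate, h]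
  induction k using Int.induction_on generalizing b with
  | zero => rw [mul_zero, scale_zero]
  | succ k ih => rw [mul_add, mul_one, ← scale_scale, ih, h1]
  | pred k ih => rw [← h1, scale_scale, mul_sub, mul_one, add_sub_cancel, ih]

theorem apply_scale_emod {q : ℕ} {χ : AddChar (Bgrp a) Circle}
    (h : (dualMap ha)^[q] χ = χ) (s : ℤ) (b : Bgrp a) :
    χ (scale ha (s % q) b) = χ (scale ha s b) := by
  conv_rhs => rw [← Int.mul_ediv_add_emod s q, ← scale_scale, apply_scale_mul_of_period ha h]

variable {ι : Type} (χ : ι → AddChar (Bgrp a) Circle) (x : ι → Circle)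

/-- The index set of the basis of `⨁ i, ℂ ^ (q i)`, with `q i` the period of `χ i`. -/
abbrev OrbitIndex : Type := Σ i, Fin (Function.minimalPeriod (dualMap ha) (χ i))

/-- The Hilbert space `⨁ i, ℂ ^ (q i)`. -/
abbrev OrbitSpace : Type := lp (fun _ : OrbitIndex ha χ => ℂ) 2

/-- The standard basis of `⨁ i, ℂ ^ (q i)`. -/
def orbitBasis : HilbertBasis (OrbitIndex ha χ) ℂ (OrbitSpace ha χ) :=
  HilbertBasis.ofRepr (LinearIsometryEquiv.refl ℂ _)

variable {χ} (hχ : ∀ i, 0 < Function.minimalPeriod (dualMap ha) (χ i))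

/-- The basis vectors of a block, continued quasi-periodically to all integers. -/
def orbitVec (i : ι) (s : ℤ) : OrbitSpace ha χ :=
  ((x i ^ (-(s / (Function.minimalPeriod (dualMap ha) (χ i) : ℤ))) : Circle) : ℂ) •
    orbitBasis ha χ ⟨i, finOfInt (hχ i) s⟩

theorem orbitVec_coe (i : ι) (s : Fin (Function.minimalPeriod (dualMap ha) (χ i))) :
    orbitVec ha x hχ i (s : ℕ) = orbitBasis ha χ ⟨i, s⟩ := by
  rw [orbitVec, finOfInt_coe, Int.ediv_eq_zero_of_lt (by positivity) (by exact_mod_cast s.2)]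
  simp

theorem orbitVec_add_mul (i : ι) (s k : ℤ) :
    orbitVec ha x hχ i (s + Function.minimalPeriod (dualMap ha) (χ i) * k) =
      ((x i ^ (-k) : Circle) : ℂ) • orbitVec ha x hχ i s := by
  have h0 : ((Function.minimalPeriod (dualMap ha) (χ i) : ℕ) : ℤ) ≠ 0 :=
    (Int.natCast_pos.2 (hχ i)).ne'
  rw [orbitVec, orbitVec, Int.add_mul_ediv_left _ _ h0,
    finOfInt_congr (hχ i) (Int.add_mul_emod_self_left _ _ _), smul_smul, ← Circle.coe_mul,
    ← zpow_add, neg_add, add_comm]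

/-- The unitary `u`, which maps `e_s` to `e_{s-1}` and `e_0` to `x e_{q-1}`. -/
def orbitShift : unitary (OrbitSpace ha χ →L[ℂ] OrbitSpace ha χ) :=
  (orbitBasis ha χ).monomial (Equiv.sigmaCongrRight fun i => cyclicPred (hχ i))
    fun p => x p.1 ^ (-((((p.2 : ℕ) : ℤ) - 1) / (Function.minimalPeriod (dualMap ha) (χ p.1) : ℤ)))

/-- With `e_{s+qk} = x ^ (-k) e_s`, the wrap-around `e_0 ↦ x e_{q-1}` becomes `e_0 ↦ e_{-1}`, so `u`
acts by one formula on all integers `s`. -/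
theorem orbitShift_apply (i : ι) (s : ℤ) :
    (orbitShift ha x hχ : OrbitSpace ha χ →L[ℂ] OrbitSpace ha χ) (orbitVec ha x hχ i s) =
      orbitVec ha x hχ i (s - 1) := by
  have h1 : ∀ s : Fin (Function.minimalPeriod (dualMap ha) (χ i)),
      (orbitShift ha x hχ : OrbitSpace ha χ →L[ℂ] OrbitSpace ha χ) (orbitBasis ha χ ⟨i, s⟩) =
        orbitVec ha x hχ i ((s : ℕ) - 1) := fun s => by
    rw [orbitShift, HilbertBasis.monomial_apply]; rfl
  rw [orbitVec, map_smul, h1, ← orbitVec_add_mul, coe_finOfInt]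
  congr 1
  have := Int.emod_add_mul_ediv s (Function.minimalPeriod (dualMap ha) (χ i))
  linarith

theorem orbitShift_zpow_apply (n : ℤ) (i : ι) (s : ℤ) :
    ((orbitShift ha x hχ ^ n : unitary _) : OrbitSpace ha χ →L[ℂ] OrbitSpace ha χ)
      (orbitVec ha x hχ i s) = orbitVec ha x hχ i (s - n) := by
  induction n using Int.induction_on generalizing s with
  | zero => simp
  | succ n ih =>
    rw [zpow_add_one, Submonoid.coe_mul, mul_apply_eq_comp, orbitShift_apply, ih]
    congr 1; ring
  | pred n ih =>
    rw [zpow_sub_one, Submonoid.coe_mul, mul_apply_eq_comp]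
    have h : orbitVec ha x hχ i s =
        (orbitShift ha x hχ : OrbitSpace ha χ →L[ℂ] OrbitSpace ha χ)
          (orbitVec ha x hχ i (s + 1)) := by
      rw [orbitShift_apply, add_sub_cancel_right]
    rw [h, ← mul_apply_eq_comp _ (orbitShift ha x hχ : OrbitSpace ha χ →L[ℂ] OrbitSpace ha χ),
      ← Submonoid.coe_mul, inv_mul_cancel, Submonoid.coe_one, one_apply_eq_self, ih]
    congr 1; ring

variable (χ) in
/-- The representation of `B_a` by diagonal operators with the characters `χ i (a ^ s b)`. -/
def orbitDiag : Multiplicative (Bgrp a) →* unitary (OrbitSpace ha χ →L[ℂ] OrbitSpace ha χ) where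
  toFun b := (orbitBasis ha χ).monomial 1 fun p => χ p.1 (scale ha (p.2 : ℕ) b.toAdd)
  map_one' := (orbitBasis ha χ).unitary_ext fun p => by
    simp [HilbertBasis.monomial_apply]
  map_mul' b c := (orbitBasis ha χ).unitary_ext fun p => by
    simp [HilbertBasis.monomial_apply, AddChar.map_add_eq_mul, smul_smul, mul_comm]

theorem orbitDiag_apply (b : Multiplicative (Bgrp a)) (i : ι) (s : ℤ) :
    (orbitDiag ha χ b : OrbitSpace ha χ →L[ℂ] OrbitSpace ha χ) (orbitVec ha x hχ i s) =
      (χ i (scale ha s b.toAdd) : ℂ) • orbitVec ha x hχ i s := by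
  change ((orbitBasis ha χ).monomial 1 _ : OrbitSpace ha χ →L[ℂ] OrbitSpace ha χ) _ = _
  rw [orbitVec, map_smul, HilbertBasis.monomial_apply, smul_comm]
  dsimp only
  rw [coe_finOfInt, apply_scale_emod ha (Function.iterate_minimalPeriod)]
  rfl

/-- The representation `⨁ i, π_{x i, χ i}` of `G_a`. -/
def orbitHom : Ggrp ha →* unitary (OrbitSpace ha χ →L[ℂ] OrbitSpace ha χ) :=
  SemidirectProduct.lift (orbitDiag ha χ) (zpowersHom _ (orbitShift ha x hχ)) fun n => by
    refine MonoidHom.ext fun b => (orbitBasis ha χ).unitary_ext fun ⟨i, s⟩ => ?_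
    rw [← orbitVec_coe ha x hχ]
    -- The covariance relation `a ^ n b = u ^ n b u ^ (-n)`: on the vector of index `s` both sides
    -- multiply by `χ (a ^ (s + n) b)`.
    change (orbitDiag ha χ (Multiplicative.ofAdd (scale ha n.toAdd b.toAdd)) :
      OrbitSpace ha χ →L[ℂ] OrbitSpace ha χ) _ =
      ((orbitShift ha x hχ ^ n.toAdd * orbitDiag ha χ b * (orbitShift ha x hχ ^ n.toAdd)⁻¹ :
        unitary _) : OrbitSpace ha χ →L[ℂ] OrbitSpace ha χ) _
    rw [← zpow_neg, Submonoid.coe_mul, Submonoid.coe_mul, mul_apply_eq_comp, mul_apply_eq_comp,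
      orbitShift_zpow_apply, orbitDiag_apply, orbitDiag_apply, map_smul, orbitShift_zpow_apply,
      toAdd_ofAdd, scale_scale, sub_neg_eq_add, add_sub_cancel_right]

/-- The representation `⨁ i, π_{x i, χ i}` of `G_a`, bundled. -/
def orbitRep [Nonempty ι] : UnitaryRep (Ggrp ha) :=
  haveI : Nonempty (OrbitIndex ha χ) := ⟨⟨Classical.arbitrary ι, ⟨0, hχ _⟩⟩⟩
  haveI : Nontrivial (OrbitSpace ha χ) :=
    ⟨⟨_, _, (orbitBasis ha χ).apply_ne_zero (Classical.arbitrary _)⟩⟩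
  { H := OrbitSpace ha χ
    ρ := orbitHom ha x hχ }

variable [Nonempty ι]

/-- The standard basis of the space of `⨁ i, π_{x i, χ i}`. -/
def orbitRepBasis : HilbertBasis (OrbitIndex ha χ) ℂ (orbitRep ha x hχ).H := orbitBasis ha χ

/-- The quasi-periodic family of vectors in the space of `⨁ i, π_{x i, χ i}`. -/
def orbitRepVec (i : ι) (s : ℤ) : (orbitRep ha x hχ).H := orbitVec ha x hχ i s

theorem orbitRepVec_eq (i : ι) (s : ℤ) : orbitRepVec ha x hχ i s =
    ((x i ^ (-(s / (Function.minimalPeriod (dualMap ha) (χ i) : ℤ))) : Circle) : ℂ) •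
      orbitRepBasis ha x hχ ⟨i, finOfInt (hχ i) s⟩ :=
  rfl

theorem orbitRepVec_coe (i : ι) (s : Fin (Function.minimalPeriod (dualMap ha) (χ i))) :
    orbitRepVec ha x hχ i (s : ℕ) = orbitRepBasis ha x hχ ⟨i, s⟩ :=
  orbitVec_coe ha x hχ i s

theorem orbitRepVec_add_mul (i : ι) (s k : ℤ) :
    orbitRepVec ha x hχ i (s + Function.minimalPeriod (dualMap ha) (χ i) * k) =
      ((x i ^ (-k) : Circle) : ℂ) • orbitRepVec ha x hχ i s :=
  orbitVec_add_mul ha x hχ i s k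

theorem orbitRep_apply (g : Ggrp ha) (i : ι) (s : ℤ) :
    ((orbitRep ha x hχ).ρ g : (orbitRep ha x hχ).H →L[ℂ] (orbitRep ha x hχ).H)
      (orbitRepVec ha x hχ i s) =
      (χ i (scale ha (s - g.right.toAdd) g.left.toAdd) : ℂ) •
        orbitRepVec ha x hχ i (s - g.right.toAdd) := by
  change ((orbitDiag ha χ g.left * orbitShift ha x hχ ^ g.right.toAdd : unitary _) :
    OrbitSpace ha χ →L[ℂ] OrbitSpace ha χ) (orbitVec ha x hχ i s) = _
  rw [Submonoid.coe_mul, mul_apply_eq_comp, orbitShift_zpow_apply, orbitDiag_apply]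
  rfl

theorem orbitRep_ofB_apply (b : Bgrp a) (i : ι) (s : ℤ) :
    ((orbitRep ha x hχ).ρ (Ggrp.ofB ha b) : (orbitRep ha x hχ).H →L[ℂ] (orbitRep ha x hχ).H)
      (orbitRepVec ha x hχ i s) = (χ i (scale ha s b) : ℂ) • orbitRepVec ha x hχ i s := by
  rw [orbitRep_apply]
  simp [Ggrp.ofB]

theorem orbitRep_u_apply (i : ι) (s : ℤ) :
    ((orbitRep ha x hχ).ρ (Ggrp.u ha) : (orbitRep ha x hχ).H →L[ℂ] (orbitRep ha x hχ).H)
      (orbitRepVec ha x hχ i s) = orbitRepVec ha x hχ i (s - 1) := by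
  rw [orbitRep_apply]
  simp [Ggrp.u]

theorem isPeriodicPointRep_orbitRep : IsPeriodicPointRep ha (orbitRep ha x hχ).toCStar := by
  refine ⟨ι, fun i => Function.minimalPeriod (dualMap ha) (χ i), χ, x, orbitRepBasis ha x hχ,
    fun i => ⟨hχ i, rfl⟩, fun i s b => ?_, fun i s t hst => ?_, fun i s t hs ht => ?_⟩
  · rw [UnitaryRep.toCStar_of, ← orbitRepVec_coe, orbitRep_ofB_apply, dualMap_iterate]
  · rw [UnitaryRep.toCStar_of, ← orbitRepVec_coe, ← orbitRepVec_coe, orbitRep_u_apply, ← hst]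
    congr 1; push_cast; ring
  · rw [UnitaryRep.toCStar_of, ← orbitRepVec_coe, ← orbitRepVec_coe, orbitRep_u_apply, hs]
    have := orbitRepVec_add_mul ha x hχ i (t : ℕ) (-1)
    rw [neg_neg, zpow_one] at this
    rw [← this]
    congr 1
    have : ((Function.minimalPeriod (dualMap ha) (χ i) : ℕ) : ℤ) = (t : ℕ) + 1 := by
      exact_mod_cast ht.symm
    rw [this]; push_cast; ring

/-- The matrix coefficient of the first basis vector of a block. -/
theorem inner_orbitRep_apply (g : Ggrp ha) (i : ι) :
    (¬ (Function.minimalPeriod (dualMap ha) (χ i) : ℤ) ∣ g.right.toAdd →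
      ⟪orbitRepVec ha x hχ i 0, ((orbitRep ha x hχ).ρ g : _ →L[ℂ] (orbitRep ha x hχ).H)
        (orbitRepVec ha x hχ i 0)⟫_ℂ = 0) ∧
    (∀ k : ℤ, g.right.toAdd = Function.minimalPeriod (dualMap ha) (χ i) * k →
      ⟪orbitRepVec ha x hχ i 0, ((orbitRep ha x hχ).ρ g : _ →L[ℂ] (orbitRep ha x hχ).H)
        (orbitRepVec ha x hχ i 0)⟫_ℂ = (χ i g.left.toAdd : ℂ) * ((x i ^ k : Circle) : ℂ)) := by
  classical
  have h0 : orbitRepVec ha x hχ i 0 = orbitRepBasis ha x hχ ⟨i, ⟨0, hχ i⟩⟩ :=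
    orbitRepVec_coe ha x hχ i ⟨0, hχ i⟩
  refine ⟨fun h => ?_, fun k hk => ?_⟩
  · rw [orbitRep_apply, inner_smul_right, zero_sub]
    rw [h0, orbitRepVec_eq, inner_smul_right, HilbertBasis.inner_eq_ite, if_neg]
    · simp
    · intro heq
      have h2 := congrArg (fun t : Fin _ => ((t : ℕ) : ℤ)) (eq_of_heq (Sigma.mk.inj heq).2)
      dsimp only at h2
      rw [coe_finOfInt, Nat.cast_zero] at h2
      exact h (Int.dvd_neg.1 (Int.dvd_of_emod_eq_zero h2.symm))
  · have h1 := orbitRepVec_add_mul ha x hχ i 0 (-k)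
    rw [neg_neg, mul_neg, ← hk] at h1
    rw [orbitRep_apply, inner_smul_right, sub_eq_add_neg, h1, inner_smul_right, zero_add]
    have h2 : ⟪orbitRepVec ha x hχ i 0, orbitRepVec ha x hχ i 0⟫_ℂ = 1 := by
      rw [h0, HilbertBasis.inner_eq_ite, if_pos rfl]
    rw [h2, mul_one, hk, ← mul_neg,
      apply_scale_mul_of_period ha (Function.iterate_minimalPeriod)]

end PeriodicRep

/-! ### Periodic characters from finite quotients, and the canonical trace as an average. -/

section QuotientCharacters

variable {a : ℝ} (m : Ideal (laurentRing a))

/-- The restriction to `B_a` of a character of a quotient of `ℤ[a, a⁻¹]`. -/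
def quotientChar (n : ℕ) (ψ : AddChar (laurentRing a ⧸ m ^ n) Circle) :
    AddChar (Bgrp a) Circle :=
  ψ.compAddMonoidHom ((Ideal.Quotient.mk (m ^ n)).toAddMonoidHom.comp (toLaurentRing a))

theorem quotientChar_apply (n : ℕ) (ψ : AddChar (laurentRing a ⧸ m ^ n) Circle) (b : Bgrp a) :
    quotientChar m n ψ b = ψ (Ideal.Quotient.mk (m ^ n) (toLaurentRing a b)) := rfl

/-- The class of `a` is a unit of a finite ring, so some positive power of it is `1`. -/
theorem minimalPeriod_quotientChar_pos (ha : 0 < a) (n : ℕ) [Finite (laurentRing a ⧸ m ^ n)]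
    (ψ : AddChar (laurentRing a ⧸ m ^ n) Circle) :
    0 < Function.minimalPeriod (dualMap ha) (quotientChar m n ψ) := by
  have hunit : IsUnit (Ideal.Quotient.mk (m ^ n) (aPow a 1)) := by
    refine IsUnit.map _ (IsUnit.of_mul_eq_one (aPow a (-1)) (Subtype.ext ?_))
    change a ^ (1 : ℤ) * a ^ (-1 : ℤ) = 1
    rw [← zpow_add₀ ha.ne', add_neg_cancel, zpow_zero]
  obtain ⟨w, hw⟩ := hunit
  obtain ⟨k, hk0, hk⟩ := isOfFinOrder_iff_pow_eq_one.1 (isOfFinOrder_of_finite w)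
  have hk' : Ideal.Quotient.mk (m ^ n) (aPow a k) = 1 := by
    have h1 : aPow a k = aPow a 1 ^ k := Subtype.ext (by
      change a ^ (k : ℤ) = (a ^ (1 : ℤ)) ^ k
      rw [zpow_one, zpow_natCast])
    rw [h1, map_pow, ← hw, ← Units.val_pow_eq_pow_val, hk, Units.val_one]
  refine Function.minimalPeriod_pos_of_mem_periodicPts ⟨k, hk0, ?_⟩
  refine DFunLike.ext _ _ fun b => ?_
  rw [dualMap_iterate, quotientChar_apply, quotientChar_apply, toLaurentRing_scale, map_mul, hk',
    one_mul]

variable {m} in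
theorem exists_forall_notMem_pow (hm : ⨅ n : ℕ, m ^ n = ⊥) (W : Finset (laurentRing a)) :
    ∃ n : ℕ, ∀ b ∈ W, b ≠ 0 → b ∉ m ^ n := by
  have h : ∀ b : laurentRing a, ∃ n : ℕ, b ≠ 0 → b ∉ m ^ n := by
    intro b
    by_contra! hc
    have : b ∈ ⨅ n : ℕ, m ^ n := (Submodule.mem_iInf _).2 fun n => (hc n).2
    rw [hm] at this
    exact (hc 0).1 this
  choose N hN using h
  exact ⟨W.sup N, fun b hb h0 h1 =>
    hN b h0 (Ideal.pow_le_pow_right (Finset.le_sup hb) h1)⟩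

variable [∀ n, Finite (laurentRing a ⧸ m ^ n)]

/-- The pairs of a character of a finite quotient and a root of unity. -/
abbrev QuotientPairs : Type :=
  (Σ n : ℕ, AddChar (laurentRing a ⧸ m ^ n) Circle) × Σ M : ℕ, ZMod (M + 1)

instance : Countable (QuotientPairs m) :=
  haveI : ∀ n, Finite (AddChar (laurentRing a ⧸ m ^ n) Circle) := fun n =>
    Finite.of_equiv _ (AddChar.circleEquivComplex (α := laurentRing a ⧸ m ^ n)).symm.toEquiv
  haveI : ∀ M : ℕ, Finite (ZMod (M + 1)) := fun _ => Finite.of_fintype _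
  inferInstance

instance : Nonempty (QuotientPairs m) := ⟨⟨0, 1⟩, ⟨0, 0⟩⟩

variable {m} in
/-- The character of a pair. -/
def QuotientPairs.char (P : QuotientPairs m) : AddChar (Bgrp a) Circle :=
  quotientChar m P.1.1 P.1.2

variable {m} in
/-- The root of unity of a pair. -/
def QuotientPairs.root (P : QuotientPairs m) : Circle := ZMod.toCircle P.2.2

/-- The bound on `|k|` prevents `M + 1` from dividing `k`, so `j ↦ toCircle j ^ k` is a nontrivial
character. -/
theorem sum_toCircle_zpow {M : ℕ} {k : ℤ} (hk : k ≠ 0) (hM : |k| < M + 1) :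
    ∑ j : ZMod (M + 1), (((ZMod.toCircle j) ^ k : Circle) : ℂ) = 0 := by
  classical
  let φ : AddChar (ZMod (M + 1)) ℂ :=
    Circle.coeHom.compAddChar (ZMod.toCircle ^ k)
  have hφ : ∀ j, φ j = (((ZMod.toCircle j) ^ k : Circle) : ℂ) := fun j => by
    simp only [φ, MonoidHom.compAddChar_apply, Function.comp_apply, AddChar.zpow_apply]
    rfl
  have h : ∑ j, φ j = 0 := by
    rw [AddChar.sum_eq_ite, if_neg]
    intro h0
    have h1 : φ 1 = 1 := by rw [h0]; rfl
    have h2 : (ZMod.toCircle (1 : ZMod (M + 1))) ^ k = 1 := Circle.ext ((hφ 1).symm.trans h1)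
    rw [← AddChar.map_zsmul_eq_zpow, ← AddChar.map_zero_eq_one (ZMod.toCircle (N := M + 1))] at h2
    have h3 := ZMod.injective_toCircle h2
    rw [zsmul_one, ZMod.intCast_zmod_eq_zero_iff_dvd] at h3
    exact hk (Int.eq_zero_of_abs_lt_dvd h3 (by exact_mod_cast hM))
  simpa only [hφ] using h

theorem sum_quotientChar (n : ℕ) [Fintype (AddChar (laurentRing a ⧸ m ^ n) Circle)]
    {b : Bgrp a} (hb : toLaurentRing a b ∉ m ^ n) :
    ∑ ψ : AddChar (laurentRing a ⧸ m ^ n) Circle, (quotientChar m n ψ b : ℂ) = 0 := by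
  classical
  have := Fintype.ofFinite (laurentRing a ⧸ m ^ n)
  have h := AddChar.sum_apply_eq_ite (Ideal.Quotient.mk (m ^ n) (toLaurentRing a b))
  rw [if_neg (fun h => hb (Ideal.Quotient.eq_zero_iff_mem.1 h))] at h
  rw [← h]
  exact Fintype.sum_equiv AddChar.circleEquivComplex.toEquiv _ _ fun ψ => rfl

variable {m}

/-- Choose `m ^ n` to avoid the nonzero `B_a`-parts of `W`, and `M` to bound its `ℤ`-parts. Then
average the first-vector coefficients over all characters `ψ` of the quotient and all `(M + 1)`-th
roots of unity. A nontrivial element with zero `ℤ`-part is killed by the sum over `ψ`. For a nonzero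
`ℤ`-part, either the period does not divide it and each coefficient vanishes, or the sum over roots
vanishes. -/
theorem hasRegularCoefficients_orbitRep (ha : 0 < a) (hm : ⨅ n : ℕ, m ^ n = ⊥)
    {ι : Type} [Nonempty ι] {P : ι → QuotientPairs m} (hP : Function.Surjective P)
    (hχ : ∀ i, 0 < Function.minimalPeriod (dualMap ha) (P i).char) :
    (orbitRep ha (χ := fun i => (P i).char) (fun i => (P i).root) hχ).HasRegularCoefficients := by
  classical
  intro W
  obtain ⟨n, hn⟩ := exists_forall_notMem_pow hm (W.image fun g => toLaurentRing a g.left.toAdd)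
  obtain ⟨M, hM⟩ : ∃ M : ℕ, ∀ g ∈ W, |g.right.toAdd| ≤ (M : ℤ) := by
    refine ⟨W.sup fun g => g.right.toAdd.natAbs, fun g hg => ?_⟩
    rw [Int.abs_eq_natAbs]
    exact_mod_cast Finset.le_sup (f := fun g : Ggrp ha => g.right.toAdd.natAbs) hg
  have : Finite (AddChar (laurentRing a ⧸ m ^ n) Circle) :=
    Finite.of_equiv _ (AddChar.circleEquivComplex (α := laurentRing a ⧸ m ^ n)).symm.toEquiv
  let _ := Fintype.ofFinite (AddChar (laurentRing a ⧸ m ^ n) Circle)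
  let J := AddChar (laurentRing a ⧸ m ^ n) Circle × ZMod (M + 1)
  choose i hi using fun q : J => hP (⟨n, q.1⟩, ⟨M, q.2⟩)
  have hchar : ∀ q, (P (i q)).char = quotientChar m n q.1 := fun q => by rw [hi]; rfl
  have hroot : ∀ q, (P (i q)).root = ZMod.toCircle q.2 := fun q => by rw [hi]; rfl
  have hper : ∀ ψ j, Function.minimalPeriod (dualMap ha) (P (i (ψ, j))).char =
      Function.minimalPeriod (dualMap ha) (quotientChar m n ψ) := fun ψ j => by rw [hchar]
  have hcard : (0 : ℝ) < Fintype.card J := by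
    have : Nonempty J := ⟨(1, 0)⟩
    exact_mod_cast Fintype.card_pos
  set r := orbitRep ha (χ := fun i => (P i).char) (fun i => (P i).root) hχ with hr
  let v : J → r.H := fun q => orbitRepVec ha (χ := fun i => (P i).char) (fun i => (P i).root) hχ
    (i q) 0
  -- Scaling the vectors by `1 / √|J|` turns the sum of coefficients into their average.
  let t : ℂ := (((Real.sqrt (Fintype.card J))⁻¹ : ℝ) : ℂ)
  have ht : (starRingEnd ℂ) t * t = (Fintype.card J : ℂ)⁻¹ := by
    rw [Complex.conj_ofReal, ← Complex.ofReal_mul, ← mul_inv, Real.mul_self_sqrt hcard.le]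
    push_cast; rfl
  have hred : ∀ g, ∑ q, ⟪t • v q, (r.ρ g : r.H →L[ℂ] r.H) (t • v q)⟫_ℂ =
      (Fintype.card J : ℂ)⁻¹ * ∑ q, ⟪v q, (r.ρ g : r.H →L[ℂ] r.H) (v q)⟫_ℂ := by
    intro g
    rw [Finset.mul_sum]
    refine Finset.sum_congr rfl fun q _ => ?_
    rw [map_smul, inner_smul_left, inner_smul_right, ← mul_assoc, ht]
  have hval := fun g q => inner_orbitRep_apply ha (χ := fun i => (P i).char)
    (fun i => (P i).root) hχ g (i q)
  refine ⟨J, inferInstance, fun q => t • v q, fun g hg => ⟨fun h1 => ?_, fun h1 => ?_⟩⟩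
  · rw [hred]
    have : ∀ q, ⟪v q, (r.ρ g : r.H →L[ℂ] r.H) (v q)⟫_ℂ = 1 := fun q => by
      refine ((hval g q).2 0 (by rw [h1, mul_zero]; rfl)).trans ?_
      have : g.left.toAdd = 0 := by rw [h1]; rfl
      rw [this]
      simp
    rw [Finset.sum_congr rfl fun q _ => this q]
    simp only [Finset.sum_const, Finset.card_univ, nsmul_eq_mul, mul_one]
    exact inv_mul_cancel₀ (by exact_mod_cast hcard.ne')
  · rw [hred]
    refine mul_eq_zero_of_right _ ?_
    by_cases h2 : g.right.toAdd = 0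
    · have hb : g.left.toAdd ≠ 0 := by
        intro hb
        exact h1 (SemidirectProduct.ext hb h2)
      have hb' := hn _ (Finset.mem_image_of_mem _ hg)
        ((map_ne_zero_iff _ (toLaurentRing_injective a)).2 hb)
      have : ∀ q, ⟪v q, (r.ρ g : r.H →L[ℂ] r.H) (v q)⟫_ℂ =
          (quotientChar m n q.1 g.left.toAdd : ℂ) := fun q => by
        refine ((hval g q).2 0 (by rw [h2, mul_zero])).trans ?_
        rw [hchar]
        simp
      rw [Finset.sum_congr rfl fun q _ => this q, Fintype.sum_prod_type, Finset.sum_comm]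
      refine Finset.sum_eq_zero fun j _ => ?_
      exact sum_quotientChar m n hb'
    · rw [Fintype.sum_prod_type]
      refine Finset.sum_eq_zero fun ψ _ => ?_
      by_cases h3 : (Function.minimalPeriod (dualMap ha) (quotientChar m n ψ) : ℤ) ∣ g.right.toAdd
      · obtain ⟨k, hk⟩ := h3
        have hk0 : k ≠ 0 := by
          rintro rfl
          exact h2 (by rw [hk, mul_zero])
        have hkM : |k| < M + 1 := by
          have h4 := hM g hg
          have h5 : |k| ∣ |g.right.toAdd| := (abs_dvd_abs _ _).2 (Dvd.intro_left _ hk.symm)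
          have := Int.le_of_dvd (abs_pos.2 h2) h5
          omega
        have : ∀ j, ⟪v (ψ, j), (r.ρ g : r.H →L[ℂ] r.H) (v (ψ, j))⟫_ℂ =
            (quotientChar m n ψ g.left.toAdd : ℂ) * (((ZMod.toCircle j) ^ k : Circle) : ℂ) := by
          intro j
          refine ((hval g (ψ, j)).2 k (by rw [hper]; exact hk)).trans ?_
          rw [hchar, hroot]
        rw [Finset.sum_congr rfl fun j _ => this j, ← Finset.mul_sum, sum_toCircle_zpow hk0 hkM,
          mul_zero]
      · exact Finset.sum_eq_zero fun j _ => (hval g (ψ, j)).1 (by rw [hper]; exact h3)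

/-- Some character of a finite quotient is not fixed. -/
theorem exists_char_minimalPeriod_ne_one (ha : 0 < a) (ha1 : a ≠ 1) (hm : ⨅ n : ℕ, m ^ n = ⊥) :
    ∃ P : QuotientPairs m, Function.minimalPeriod (dualMap ha) P.char ≠ 1 := by
  let one : Bgrp a := ⟨1, by simpa using zpow_mem_Bgrp a 0⟩
  -- This is `a - 1`, nonzero because `a ≠ 1`; a fixed character would be trivial on it.
  let b : Bgrp a := scale ha 1 one - one
  have hb : b ≠ 0 := by
    intro h
    have h1 : a ^ (1 : ℤ) * 1 - 1 = 0 := congrArg Subtype.val h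
    rw [zpow_one, mul_one, sub_eq_zero] at h1
    exact ha1 h1
  obtain ⟨n, hn⟩ := exists_forall_notMem_pow hm {toLaurentRing a b}
  have hb' := hn _ (Finset.mem_singleton_self _)
    ((map_ne_zero_iff _ (toLaurentRing_injective a)).2 hb)
  obtain ⟨ψ, hψ⟩ := (AddChar.exists_apply_ne_zero
    (a := Ideal.Quotient.mk (m ^ n) (toLaurentRing a b))).2
      (fun h => hb' (Ideal.Quotient.eq_zero_iff_mem.1 h))
  refine ⟨(⟨n, AddChar.circleEquivComplex.symm ψ⟩, ⟨0, 0⟩), fun h => hψ ?_⟩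
  have hfix : dualMap ha (quotientChar m n (AddChar.circleEquivComplex.symm ψ)) =
      quotientChar m n (AddChar.circleEquivComplex.symm ψ) :=
    Function.minimalPeriod_eq_one_iff_isFixedPt.1 h
  have h1 := congrArg (fun χ => χ one) hfix
  have h2 : quotientChar m n (AddChar.circleEquivComplex.symm ψ) b = 1 := by
    rw [AddChar.map_sub_eq_div, div_eq_one]
    exact h1
  rw [quotientChar_apply] at h2
  have h3 := congrArg (fun z : Circle => (z : ℂ)) h2
  rw [← AddChar.circleEquivComplex.apply_symm_apply ψ]
  exact h3

end QuotientCharacters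

/-! ### A sequence with critical exponent exactly one. -/

section Weights

/-- The pairs `(n, k)` with `k < 2 ^ n`. -/
abbrev WeightIndex : Type := Σ n : ℕ, Fin (2 ^ n)

/-- Numbers whose inverses have a finite sum, while the powers of the inverses with any exponent
below `1` have an infinite sum: `2 ^ n (n + 1) ^ 2`, repeated `2 ^ n` times. -/
def weight (i : WeightIndex) : ℝ := 2 ^ i.1 * ((i.1 : ℝ) + 1) ^ 2

theorem one_le_weight (i : WeightIndex) : 1 ≤ weight i := by
  unfold weight
  have h1 : (1 : ℝ) ≤ 2 ^ i.1 := one_le_pow₀ (by norm_num)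
  have h2 : (1 : ℝ) ≤ ((i.1 : ℝ) + 1) ^ 2 := one_le_pow₀ (by linarith [Nat.cast_nonneg (α := ℝ) i.1])
  nlinarith

/-- Level `n` contributes `2 ^ n / (2 ^ n (n + 1)²) = (n + 1)⁻²`. -/
theorem summable_inv_weight : Summable fun i => (weight i)⁻¹ := by
  rw [summable_sigma_of_nonneg fun i => inv_nonneg.2 (zero_le_one.trans (one_le_weight i))]
  refine ⟨fun n => Summable.of_finite, ?_⟩
  have h : (fun n : ℕ => ∑' k : Fin (2 ^ n), (weight ⟨n, k⟩)⁻¹) =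
      fun n : ℕ => (((n + 1 : ℕ) : ℝ) ^ 2)⁻¹ := by
    ext n
    rw [tsum_fintype]
    simp only [weight, Finset.sum_const, Finset.card_univ, Fintype.card_fin, nsmul_eq_mul]
    push_cast
    field_simp
  rw [h]
  exact (summable_nat_add_iff 1).2 (Real.summable_nat_pow_inv.2 one_lt_two)

/-- Level `n` contributes `2 ^ (n (1 - s)) * (n + 1) ^ (-2 s)`, whose exponential factor keeps it
from tending to zero. -/
theorem not_summable_weight_rpow {s : ℝ} (hs0 : 0 < s) (hs : s < 1) :
    ¬ Summable fun i => (weight i) ^ (-s) := by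
  intro h
  rw [summable_sigma_of_nonneg
    fun i => Real.rpow_nonneg (zero_le_one.trans (one_le_weight i)) _] at h
  have h1 : ∀ n : ℕ, ∑' k : Fin (2 ^ n), (weight ⟨n, k⟩) ^ (-s) =
      ((2 : ℝ) ^ (1 - s)) ^ n * (((n : ℝ) + 1) ^ 2) ^ (-s) := by
    intro n
    rw [tsum_fintype]
    simp only [weight, Finset.sum_const, Finset.card_univ, Fintype.card_fin, nsmul_eq_mul]
    rw [Real.mul_rpow (by positivity) (by positivity), ← mul_assoc]
    congr 1
    push_cast
    rw [← Real.rpow_natCast, ← Real.rpow_mul zero_le_two, ← Real.rpow_add two_pos,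
      ← Real.rpow_natCast, ← Real.rpow_mul zero_le_two]
    congr 1; ring
  have h2 := h.2.tendsto_atTop_zero
  simp only [h1] at h2
  set c : ℝ := (2 : ℝ) ^ (1 - s) with hc
  have hc1 : 1 < c := Real.one_lt_rpow one_lt_two (by linarith)
  have h3 : Filter.Tendsto (fun n : ℕ => ((n : ℝ) ^ 2) / c ^ n) Filter.atTop (nhds 0) :=
    tendsto_pow_const_div_const_pow_of_one_lt 2 hc1
  have h4 := (h3.comp (Filter.tendsto_add_atTop_nat 1)).mul_const c
  have h5 := h2.eventually_lt_const one_pos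
  have h6 := h4.eventually_lt_const (show (0 : ℝ) * c < 1 by simp)
  obtain ⟨n, hn5, hn6⟩ := (h5.and h6).exists
  simp only [Function.comp] at hn6
  push_cast at hn6
  have hn : (1 : ℝ) ≤ ((n : ℝ) + 1) ^ 2 :=
    one_le_pow₀ (by linarith [Nat.cast_nonneg (α := ℝ) n])
  have h7 : (((n : ℝ) + 1) ^ 2)⁻¹ ≤ (((n : ℝ) + 1) ^ 2) ^ (-s) := by
    rw [← Real.rpow_neg_one]
    exact Real.rpow_le_rpow_of_exponent_le hn (by linarith)
  have hcn : 0 < c ^ n := by positivity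
  have h8 : c ^ n < ((n : ℝ) + 1) ^ 2 := by
    have h9 : c ^ n * (((n : ℝ) + 1) ^ 2)⁻¹ < 1 :=
      lt_of_le_of_lt (mul_le_mul_of_nonneg_left h7 hcn.le) hn5
    rwa [← div_eq_mul_inv, div_lt_one (by positivity)] at h9
  rw [pow_succ c n, div_mul_eq_mul_div, div_lt_one (by positivity)] at hn6
  nlinarith

end Weights

/-! ### Summability of the eigenvalues, uniformly in the block dimensions. -/

section Eigenvalues

variable {q : WeightIndex → ℕ} (hq : ∀ i, 0 < q i) {p : ℝ} (hp : 1 ≤ p)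
  {Λ : (Σ i, Fin (q i)) → ℝ}
  (h1 : ∀ i s, (q i * weight i) ^ p⁻¹ ≤ Λ ⟨i, s⟩)
  (h2 : ∀ i s, Λ ⟨i, s⟩ ≤ (q i * weight i) ^ p⁻¹ + 1)

include hq in
theorem one_le_mul_weight (i : WeightIndex) : 1 ≤ q i * weight i := by
  have : (1 : ℝ) ≤ q i := by exact_mod_cast hq i
  nlinarith [one_le_weight i]

-- The factor `q i` cancels the dimension of the block, leaving the series of inverse weights.
include hq in
theorem summable_inv_mul_weight :
    Summable fun j : Σ i, Fin (q i) => (q j.1 * weight j.1)⁻¹ := by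
  rw [summable_sigma_of_nonneg fun j =>
    inv_nonneg.2 (zero_le_one.trans (one_le_mul_weight hq j.1))]
  refine ⟨fun n => Summable.of_finite, summable_inv_weight.congr fun i => ?_⟩
  have hqi : (q i : ℝ) ≠ 0 := by exact_mod_cast (hq i).ne'
  rw [tsum_fintype]
  simp only [Finset.sum_const, Finset.card_univ, Fintype.card_fin, nsmul_eq_mul]
  rw [mul_inv, mul_inv_cancel_left₀ hqi]

include hq hp h1 in
theorem one_le_eigenvalue (j : Σ i, Fin (q i)) : 1 ≤ Λ j :=
  (Real.one_le_rpow (one_le_mul_weight hq j.1) (by positivity)).trans (h1 j.1 j.2)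

include hq hp h1 in
theorem tendsto_eigenvalue : Filter.Tendsto Λ Filter.cofinite Filter.atTop := by
  have hz := (summable_inv_mul_weight hq).tendsto_cofinite_zero
  have hz' : Filter.Tendsto (fun j : Σ i, Fin (q i) => (q j.1 * weight j.1)⁻¹) Filter.cofinite
      (nhdsWithin 0 (Set.Ioi 0)) :=
    tendsto_nhdsWithin_iff.2 ⟨hz, Filter.Eventually.of_forall fun j =>
      inv_pos.2 (one_pos.trans_le (one_le_mul_weight hq j.1))⟩
  have ht := hz'.inv_tendsto_nhdsGT_zero
  refine Filter.tendsto_atTop_mono (fun j => h1 j.1 j.2)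
    ((tendsto_rpow_atTop (show 0 < p⁻¹ by positivity)).comp ?_)
  refine ht.congr fun j => ?_
  simp

include hq hp h1 in
theorem summable_eigenvalue : Summable fun j => ((1 + Λ j ^ 2)⁻¹) ^ (p / 2) := by
  refine Summable.of_nonneg_of_le (fun j => by positivity) (fun j => ?_)
    (summable_inv_mul_weight hq)
  have hw := one_le_mul_weight hq j.1
  have hw0 : 0 < q j.1 * weight j.1 := one_pos.trans_le hw
  set y := (q j.1 * weight j.1) ^ p⁻¹ with hy
  have hy0 : 0 < y := by positivity
  have hle : y ≤ Λ j := h1 j.1 j.2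
  calc ((1 + Λ j ^ 2)⁻¹) ^ (p / 2) ≤ ((y ^ 2)⁻¹) ^ (p / 2) := by
        refine Real.rpow_le_rpow (by positivity) ?_ (by positivity)
        refine inv_anti₀ (by positivity) ?_
        nlinarith
    _ = (q j.1 * weight j.1)⁻¹ := by
        rw [Real.inv_rpow (by positivity), ← Real.rpow_natCast, ← Real.rpow_mul hy0.le, hy,
          ← Real.rpow_mul hw0.le]
        have : p⁻¹ * (((2 : ℕ) : ℝ) * (p / 2)) = 1 := by
          push_cast; field_simp
        rw [this, Real.rpow_one]

include hq hp h1 h2 in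
theorem not_summable_eigenvalue {r : ℝ} (hr : 1 ≤ r) (hrp : r < p) :
    ¬ Summable fun j => ((1 + Λ j ^ 2)⁻¹) ^ (r / 2) := by
  intro h
  rw [summable_sigma_of_nonneg fun j => by positivity] at h
  have hp0 : 0 < p := by linarith
  have hs0 : 0 < r / p := by positivity
  have hs1 : r / p < 1 := (div_lt_one hp0).2 hrp
  refine not_summable_weight_rpow hs0 hs1 ?_
  -- With `y = (q w) ^ (1/p) ≥ 1` and `Λ ≤ y + 1 ≤ 2 y` one gets `1 + Λ² ≤ 5 y²`.
  have h5 : (0 : ℝ) < (5⁻¹ : ℝ) ^ (r / 2) := by positivity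
  rw [← summable_mul_left_iff h5.ne']
  refine Summable.of_nonneg_of_le (fun i => ?_) (fun i => ?_) h.2
  · have := one_le_weight i
    positivity
  · have hw := one_le_mul_weight hq i
    have hw0 : 0 < q i * weight i := one_pos.trans_le hw
    have hwi : 0 < weight i := one_pos.trans_le (one_le_weight i)
    have hqi : (1 : ℝ) ≤ q i := by exact_mod_cast hq i
    have hqi0 : (0 : ℝ) < q i := by linarith
    set y := (q i * weight i) ^ p⁻¹ with hy
    have hy1 : 1 ≤ y := Real.one_le_rpow hw (by positivity)
    have hterm : ∀ s, (5⁻¹ : ℝ) ^ (r / 2) * (q i * weight i) ^ (-(r / p)) ≤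
        ((1 + Λ ⟨i, s⟩ ^ 2)⁻¹) ^ (r / 2) := by
      intro s
      calc (5⁻¹ : ℝ) ^ (r / 2) * (q i * weight i) ^ (-(r / p)) = ((5 * y ^ 2)⁻¹) ^ (r / 2) := by
            rw [mul_inv, Real.mul_rpow (x := 5⁻¹) (by positivity) (by positivity),
              Real.inv_rpow (by positivity : 0 ≤ y ^ 2), ← Real.rpow_natCast,
              ← Real.rpow_mul (by positivity), hy, ← Real.rpow_mul hw0.le,
              Real.rpow_neg hw0.le]
            congr 3
            push_cast; field_simp
        _ ≤ _ := by
            refine Real.rpow_le_rpow (by positivity) ?_ (by positivity)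
            refine inv_anti₀ (by positivity) ?_
            have hl := h1 i s
            have hu := h2 i s
            nlinarith
    calc (5⁻¹ : ℝ) ^ (r / 2) * weight i ^ (-(r / p))
        ≤ q i * ((5⁻¹ : ℝ) ^ (r / 2) * (q i * weight i) ^ (-(r / p))) := by
          rw [Real.mul_rpow hqi0.le hwi.le]
          -- Since `r / p < 1`, summing over the block of dimension `q i` can only help divergence;
          -- the dimensions need no upper bound.
          have hone : 1 ≤ (q i : ℝ) * (q i : ℝ) ^ (-(r / p)) := by
            nth_rewrite 1 [← Real.rpow_one (q i : ℝ)]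
            rw [← Real.rpow_add hqi0]
            exact Real.one_le_rpow hqi (by linarith)
          calc _ = 1 * ((5⁻¹ : ℝ) ^ (r / 2) * weight i ^ (-(r / p))) := (one_mul _).symm
            _ ≤ ((q i : ℝ) * (q i : ℝ) ^ (-(r / p))) *
                ((5⁻¹ : ℝ) ^ (r / 2) * weight i ^ (-(r / p))) := by gcongr
            _ = _ := by ring
      _ = ∑ _s : Fin (q i), ((5⁻¹ : ℝ) ^ (r / 2) * (q i * weight i) ^ (-(r / p))) := by simp
      _ ≤ ∑ s : Fin (q i), ((1 + Λ ⟨i, s⟩ ^ 2)⁻¹) ^ (r / 2) :=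
          Finset.sum_le_sum fun s _ => hterm s
      _ = _ := (tsum_fintype _).symm

end Eigenvalues

/-! ### Assembly of the spectral triples. -/

section Triples

variable {a : ℝ} (ha : 0 < a)

/-- `G_a` is generated by `B_a` and `u`. -/
theorem UnitaryRep.mem_of_generators (r : UnitaryRep (Ggrp ha))
    (S : StarSubalgebra ℂ (r.H →L[ℂ] r.H))
    (hB : ∀ b, (r.ρ (Ggrp.ofB ha b) : r.H →L[ℂ] r.H) ∈ S)
    (hu : (r.ρ (Ggrp.u ha) : r.H →L[ℂ] r.H) ∈ S) (g : Ggrp ha) :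
    (r.ρ g : r.H →L[ℂ] r.H) ∈ S := by
  let T : Subgroup (Ggrp ha) :=
    { carrier := {g | (r.ρ g : r.H →L[ℂ] r.H) ∈ S}
      one_mem' := by
        change ((r.ρ 1 : unitary _) : r.H →L[ℂ] r.H) ∈ S
        rw [map_one]; exact one_mem S
      mul_mem' := fun {g h} hg hh => by
        change ((r.ρ (g * h) : unitary _) : r.H →L[ℂ] r.H) ∈ S
        rw [map_mul]; exact mul_mem hg hh
      inv_mem' := fun {g} hg => by
        change ((r.ρ g⁻¹ : unitary _) : r.H →L[ℂ] r.H) ∈ S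
        rw [map_inv]; exact star_mem (s := S) hg }
  have hr : (SemidirectProduct.inr g.right : Ggrp ha) = Ggrp.u ha ^ g.right.toAdd := by
    rw [Ggrp.u, ← map_zpow, ← ofAdd_zsmul]
    simp
  have : g ∈ T := by
    rw [← SemidirectProduct.inl_left_mul_inr_right g, hr]
    exact T.mul_mem (hB g.left.toAdd) (T.zpow_mem hu _)
  exact this

/-- For every `p ≥ 1` there are spectral triples of summability exactly `p` whose Dirac operator
is constant (`t = 0`) or a nonconstant perturbation of a constant (`t = 1`) on each block. -/
theorem exists_spectralTriple (ha1 : a ≠ 1) {p : ℝ} (hp : 1 ≤ p) {t : ℝ} (ht0 : 0 ≤ t)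
    (ht1 : t ≤ 1) :
    ∃ T : SpectralTriple (Ualg ha) (Galg ha), IsPeriodicPointRep ha T.π ∧ T.HasSummability p ∧
      T.CommutatorEqZero (GroupCStar.of (Ggrp.v ha)) ∧
      (t = 0 → ∀ x, T.CommutatorEqZero x) ∧
      (t ≠ 0 → T.CommutatorNeZero (GroupCStar.of (Ggrp.u ha))) := by
  classical
  obtain ⟨m, hfin, hm⟩ := exists_ideal_finite_quotient_pow a
  obtain ⟨f, hf⟩ := exists_surjective_nat (QuotientPairs m)
  -- All `2 ^ n` indices of level `n` carry the same pair; repeating summands is harmless, and every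
  -- pair occurs.
  let P : WeightIndex → QuotientPairs m := fun i => f i.1
  have hP : Function.Surjective P := fun y => by
    obtain ⟨n, rfl⟩ := hf y
    exact ⟨⟨n, ⟨0, by positivity⟩⟩, rfl⟩
  have hχ : ∀ i, 0 < Function.minimalPeriod (dualMap ha) (P i).char := fun i =>
    minimalPeriod_quotientChar_pos m ha _ _
  have : Nonempty WeightIndex := ⟨⟨0, ⟨0, by positivity⟩⟩⟩
  let χ : WeightIndex → AddChar (Bgrp a) Circle := fun i => (P i).char
  let x : WeightIndex → Circle := fun i => (P i).root
  let q : WeightIndex → ℕ := fun i => Function.minimalPeriod (dualMap ha) (χ i)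
  have hq : ∀ i, 0 < q i := hχ
  let r : UnitaryRep (Ggrp ha) := orbitRep ha (χ := χ) x hχ
  let e : HilbertBasis (OrbitIndex ha χ) ℂ r.H := orbitRepBasis ha x hχ
  let Λ : OrbitIndex ha χ → ℝ := fun j =>
    (q j.1 * weight j.1) ^ p⁻¹ + if (j.2 : ℕ) = 0 then t else 0
  have h1 : ∀ i s, (q i * weight i) ^ p⁻¹ ≤ Λ ⟨i, s⟩ := fun i s => by
    dsimp only [Λ]; split_ifs <;> linarith
  have h2 : ∀ i s, Λ ⟨i, s⟩ ≤ (q i * weight i) ^ p⁻¹ + 1 := fun i s => by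
    dsimp only [Λ]; split_ifs <;> linarith
  have hΛ1 := one_le_eigenvalue hq hp h1
  obtain ⟨K, hK, hKsa, hKe, hdense, hDsa, hres, htr⟩ :=
    exists_diagonal_dirac e Λ hΛ1 (tendsto_eigenvalue hq hp h1)
  have hΛ0 : ∀ j, (Λ j : ℂ) ≠ 0 := fun j =>
    Complex.ofReal_ne_zero.2 (one_pos.trans_le (hΛ1 j)).ne'
  -- Since `u` takes `e_s` to a multiple of `e_{s-1}`, the commutator acts on `e_s` as `(Λ_{s-1} -
  -- Λ_s) u`. Hence `[D, u] = U Δ` with `Δ` diagonal and bounded by `1`.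
  let δ : OrbitIndex ha χ → ℝ := fun j => Λ ⟨j.1, finOfInt (hχ j.1) ((j.2 : ℕ) - 1)⟩ - Λ j
  obtain ⟨Δ, hΔ, -⟩ := e.exists_diag (fun j => (δ j : ℂ)) 1 zero_le_one (fun ⟨i, s⟩ => by
    rw [Complex.norm_real, Real.norm_eq_abs, abs_le]
    dsimp only [δ]
    constructor <;>
      linarith [h1 i s, h2 i s, h1 i (finOfInt (hχ i) ((s : ℕ) - 1)),
        h2 i (finOfInt (hχ i) ((s : ℕ) - 1))])
  have hKv : ∀ i s, K (orbitRepVec ha x hχ i s) =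
      (((Λ ⟨i, finOfInt (hχ i) s⟩)⁻¹ : ℝ) : ℂ) • orbitRepVec ha x hχ i s := fun i s => by
    rw [orbitRepVec_eq, map_smul]
    exact (congrArg _ (hKe _)).trans (smul_comm _ _ _)
  have heE : ∀ i s, e ⟨i, s⟩ = orbitRepVec ha x hχ i (s : ℕ) := fun i s =>
    (orbitRepVec_coe ha x hχ i s).symm
  let U : r.H →L[ℂ] r.H := (r.ρ (Ggrp.u ha) : r.H →L[ℂ] r.H)
  have hUe : ∀ i s, U (e ⟨i, s⟩) = orbitRepVec ha x hχ i ((s : ℕ) - 1) := fun i s => by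
    rw [heE]; exact orbitRep_u_apply ha x hχ i _
  have hBK : ∀ b, (r.ρ (Ggrp.ofB ha b) : r.H →L[ℂ] r.H) * K =
      K * (r.ρ (Ggrp.ofB ha b) : r.H →L[ℂ] r.H) := fun b => e.clm_ext fun ⟨i, s⟩ => by
    have hb : (r.ρ (Ggrp.ofB ha b) : r.H →L[ℂ] r.H) (e ⟨i, s⟩) =
        (χ i (scale ha (s : ℕ) b) : ℂ) • e ⟨i, s⟩ := by
      rw [heE]; exact orbitRep_ofB_apply ha x hχ b i _
    rw [mul_apply_eq_comp, mul_apply_eq_comp, hKe, map_smul, hb, map_smul, hKe, smul_comm]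
  have hUK : U * K - K * U = K * (U * Δ) * K := e.clm_ext fun ⟨i, s⟩ => by
    simp only [sub_apply, mul_apply_eq_comp, hKe, hΔ, map_smul, hUe, hKv, smul_smul, ← sub_smul]
    congr 1
    have ha1 := hΛ0 ⟨i, s⟩
    have ha2 := hΛ0 ⟨i, finOfInt (hχ i) ((s : ℕ) - 1)⟩
    dsimp only [δ]
    push_cast
    field_simp
  have hG : FolnerCondition (Ggrp ha) := Ggrp.folnerCondition ha
  have hreg : r.HasRegularCoefficients := hasRegularCoefficients_orbitRep ha hm hP hχ
  let S := boundedCommutatorSubalgebra K hKsa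
  have hS : ∀ g, (r.ρ g : r.H →L[ℂ] r.H) ∈ S :=
    r.mem_of_generators ha S (fun b => ⟨0, by rw [hBK]; simp⟩) ⟨U * Δ, hUK⟩
  let T : SpectralTriple (Ualg ha) (Galg ha) :=
    { H := r.H
      π := r.toCStar
      D := invPMap K hK
      dense_alg := groupAlg_dense
      faithful := UnitaryRep.toCStar_injective hG hreg
      dense_domain := hdense
      selfAdjoint := hDsa
      bounded_commutator := fun y hy => by
        obtain ⟨C, hC⟩ := r.toCStar_mem S hS hy
        exact ⟨C, isCommutator_invPMap hC⟩
      compact_resolvent := hres }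
  have hzero : ∀ y, r.toCStar y * K = K * r.toCStar y → T.CommutatorEqZero y := fun y hy =>
    isCommutator_invPMap (K := K) (hK := hK) (b := r.toCStar y) (C := 0) (by rw [hy]; simp)
  refine ⟨T, isPeriodicPointRep_orbitRep ha x hχ, ⟨?_, fun s hs hsp => ?_⟩, hzero _ (hBK _),
    fun ht => ?_, fun ht => ⟨U * Δ, isCommutator_invPMap hUK, fun h0 => ?_⟩⟩
  · exact (htr (p / 2) (by positivity)).2 (summable_eigenvalue hq hp h1)
  · exact fun h => not_summable_eigenvalue hq hp h1 h2 hs hsp ((htr (s / 2) (by positivity)).1 h)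
  · have hδ : ∀ j, δ j = 0 := fun j => by simp [δ, Λ, ht]
    have hΔ0 : Δ = 0 := e.clm_ext fun j => by rw [hΔ, hδ]; simp
    rw [hΔ0] at hUK
    simp only [mul_zero, zero_mul, sub_eq_zero] at hUK
    -- For `t = 0` the generators commute with `K`, hence so does the group algebra, and by density
    -- and continuity all of `U_a`.
    have hcomm : ∀ g, (r.ρ g : r.H →L[ℂ] r.H) ∈ StarSubalgebra.centralizer ℂ {K} := by
      refine r.mem_of_generators ha _ (fun b => ?_) ?_ <;>
      · rw [StarSubalgebra.mem_centralizer_iff]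
        rintro _ rfl
        rw [hKsa.star_eq]
        first
          | exact ⟨(hBK b).symm, (hBK b).symm⟩
          | exact ⟨hUK.symm, hUK.symm⟩
    have hclosed : IsClosed {y : Ualg ha | r.toCStar y * K = K * r.toCStar y} :=
      isClosed_eq (r.continuous_toCStar.mul continuous_const)
        (continuous_const.mul r.continuous_toCStar)
    intro y
    refine hzero y (closure_minimal (fun z hz => ?_) hclosed (groupAlg_dense y))
    have := StarSubalgebra.mem_centralizer_iff ℂ |>.1 (r.toCStar_mem _ hcomm hz) K rfl
    exact this.1.symm
  -- On a one-dimensional block `D` is scalar and the commutator vanishes, so a block of period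
  -- above one is needed. There the predecessor of index `0` differs from `0`, and the first vector
  -- is sent to `-t` times a unit vector.
  · obtain ⟨Q, hQ⟩ := exists_char_minimalPeriod_ne_one ha ha1 hm
    obtain ⟨i, rfl⟩ := hP Q
    have hqi : 1 < q i := lt_of_le_of_ne (hq i) (Ne.symm hQ)
    have hne : ((finOfInt (hχ i) (((0 : ℕ) : ℤ) - 1) : Fin _) : ℕ) ≠ 0 := by
      intro h
      have h3 := coe_finOfInt (hχ i) (((0 : ℕ) : ℤ) - 1)
      rw [h] at h3
      have h4 : (q i : ℤ) ∣ ((0 : ℕ) : ℤ) - 1 := Int.dvd_of_emod_eq_zero h3.symm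
      have h5 := Int.le_of_dvd one_pos (by simpa using h4)
      omega
    have hδ : δ ⟨i, ⟨0, hq i⟩⟩ = -t := by
      dsimp only [δ, Λ]
      rw [if_neg hne, if_pos rfl]
      ring
    have h3 : (U * Δ) (e ⟨i, ⟨0, hq i⟩⟩) = ((-t : ℝ) : ℂ) • U (e ⟨i, ⟨0, hq i⟩⟩) := by
      rw [mul_apply_eq_comp, hΔ, map_smul, hδ]
    rw [h0] at h3
    have h4 : U (e ⟨i, ⟨0, hq i⟩⟩) = 0 := by
      refine (smul_eq_zero.1 h3.symm).resolve_left ?_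
      simpa using ht
    have h5 := r.norm_apply (Ggrp.u ha) (e ⟨i, ⟨0, hq i⟩⟩)
    rw [e.orthonormal.1] at h5
    change ‖U _‖ = 1 at h5
    rw [h4, norm_zero] at h5
    exact zero_ne_one h5

end Triples

end

theorem theorem5p3 (a : ℝ) (ha : 0 < a) (ha1 : a ≠ 1) :
    (∃ T : SpectralTriple (Ualg ha) (Galg ha),
      IsPeriodicPointRep ha T.π ∧ T.IsCompactTriple) ∧
    (∀ p : ℝ, 1 ≤ p → ∃ T : SpectralTriple (Ualg ha) (Galg ha),
      IsPeriodicPointRep ha T.π ∧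
      (∀ x : Ualg ha, T.CommutatorEqZero x) ∧ T.HasSummability p) ∧
    (IsAlgebraic ℚ a → ∀ p : ℝ, 2 ≤ p → ∃ T : SpectralTriple (Ualg ha) (Galg ha),
      IsPeriodicPointRep ha T.π ∧
      T.CommutatorEqZero (GroupCStar.of (Ggrp.v ha)) ∧
      T.CommutatorNeZero (GroupCStar.of (Ggrp.u ha)) ∧ T.HasSummability p) := by
  refine ⟨?_, fun p hp => ?_, fun _ p hp => ?_⟩
  -- Compactness comes for free from zero commutators; the exponent `p = 1` is an arbitrary choice.
  · obtain ⟨T, hT, -, -, h0, -⟩ := exists_spectralTriple ha ha1 le_rfl le_rfl zero_le_one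
    exact ⟨T, hT, fun x _ => ⟨0, h0 rfl x, isCompactOperator_zero⟩⟩
  · obtain ⟨T, hT, hs, -, h0, -⟩ := exists_spectralTriple ha ha1 hp le_rfl zero_le_one
    exact ⟨T, hT, h0 rfl, hs⟩
  · obtain ⟨T, hT, hs, hv, -, hu⟩ :=
      exists_spectralTriple ha ha1 (one_le_two.trans hp) zero_le_one le_rfl
    exact ⟨T, hT, hv, hu one_ne_zero, hs⟩
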